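/- Let $n\ge 3$, and let a spherical doubly warped (DW) spacetime of dimension $n$ be given by the metric $$ds^2=-b^2(r)\,dt^2+a^2(t)\left[f_1^2(r)\,dr^2+f_2^2(r)\,d\Omega^2_{n-2}\right],$$ where $a,b,f_1,f_2>0$ are (at least) twice continuously differentiable, $t$ and $r$ range in open sets, and $d\Omega^2_{n-2}$ is the metric of the unit sphere $S_{n-2}$ in arbitrary smooth local coordinates. Notation. $R_{jkl}{}^m=-\partial_j\Gamma^m_{kl}+\partial_k\Gamma^m_{jl}+\Gamma^p_{jl}\Gamma^m_{kp}-\Gamma^p_{kl}\Gamma^m_{jp}$, the Ricci tensor is $R_{kl}=-R_{jkl}{}^j$, and $R$ is its trace. The comoving velocity $u_j$ has components $u_0=-b$, $u_\mu=0$. A dot is $u^k\nabla_k$; $\dot u_j=u^k\nabla_ku_j$, $h_{jk}=g_{jk}+u_ju_k$, $\varphi=\nabla_ju^j/(n-1)$, $\xi=(n-1)(\varphi^2+\dot\varphi)$, $\eta=\dot u_j\dot u^j$. $N_j$ is the unit radial covector, with only nonzero component $N_r=af_1$. With $$C_{jklm}=R_{jklm}+\frac{g_{jm}R_{kl}-g_{km}R_{jl}+R_{jm}g_{kl}-R_{km}g_{jl}}{n-2}-R\,\frac{g_{jm}g_{kl}-g_{km}g_{jl}}{(n-1)(n-2)}$$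 the electric tensor is $E_{kl}=u^ju^mC_{jklm}$, and $$E(r)=\frac{n-3}{n-2}\,\frac1{f_1^2}\left[\frac{f_1^2}{f_2^2}+\frac{d^2}{dr^2}\log f_2-\frac{f_1'f_2'}{f_1f_2}+\frac{b'}{b}\frac{d}{dr}\log(f_1f_2)-\frac{b''}{b}\right].$$ Then: (0) $E_{jk}=\dfrac{E(r)}{a^2(t)}\left[N_jN_k-\dfrac{h_{jk}}{n-1}\right]$ at every point. (1) At every point where $\dot u\ne0$, one has $N_jN_k=\dot u_j\dot u_k/\eta$ and $$R_{jk}=u_ju_k(-\xi+\nabla_p\dot u^p)+\frac{h_{jk}}{n-1}(R-\xi+\nabla_p\dot u^p)-(n-2)\varphi(u_j\dot u_k+\dot u_ju_k)$$ $$\qquad+\left[\frac{\dot u_j\dot u_k}{\eta}-\frac{h_{jk}}{n-1}\right]\left[\nabla_p\dot u^p-(n-1)\left(\eta+\frac{\dot u^i\nabla_i\eta}{2\eta}\right)-(n-2)\frac{E(r)}{a^2(t)}\right].$$ (2) If $\dot u$ vanishes identically, then $$R_{jk}=-\xi u_ju_k+\frac{R-\xi}{n-1}h_{jk}-(n-2)\left[N_jN_k-\frac{h_{jk}}{n-1}\right]\frac{E(r)}{a^2(t)}.$$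 (3) If the Einstein equations $R_{ij}-\frac12Rg_{ij}=T_{ij}$ hold, then $T_{ij}$ is the energy-momentum tensor of an anisotropic fluid: at every point $$T_{ij}=\mu u_iu_j+Ph_{ij}+(u_iq_j+u_jq_i)+\left[N_iN_j-\frac{h_{ij}}{n-1}\right](p_r-p_\perp),$$ where $\mu=T_{ij}u^iu^j$ is the energy density, $q_j=-h_j{}^kT_{kl}u^l$ the heat flux, $p_r=T_{ij}N^iN^j$ the radial pressure, $p_\perp=(h^{ij}-N^iN^j)T_{ij}/(n-2)$ the tangential pressure, and $P=h^{ij}T_{ij}/(n-1)=\frac1{n-1}p_r+\frac{n-2}{n-1}p_\perp$ the effective pressure. They are given by $$\mu=-\xi+\nabla_p\dot u^p+\tfrac12R,\qquad (n-1)P=-\xi+\nabla_p\dot u^p-\tfrac12(n-3)R,\qquad q_j=-(n-2)\varphi\,\dot u_j,$$ $$p_r-p_\perp=\nabla_p\dot u^p-(n-1)\left(\eta+\frac{\dot u^i\nabla_i\eta}{2\eta}\right)-(n-2)\frac{E(r)}{a^2(t)}\quad\text{at points where }\dot u\ne0,$$ and $p_r-p_\perp=-(n-2)E(r)/a^2(t)$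 if $\dot u$ vanishes identically. -/

import Mathlib

open scoped ContDiff

noncomputable section

/-! ## Pseudo-Riemannian geometry in a coordinate chart

Coordinates are indexed by a finite type `ι`; a point of the chart is `x : ι → ℝ`, and tensor fields
are given by their components as functions of the point. The dimension is `n = Fintype.card ι`. -/

namespace ChartGeometry

variable {ι : Type} [Fintype ι] [DecidableEq ι]

/-- Partial derivative `∂_i f` at `x`. -/
def pd (i : ι) (f : (ι → ℝ) → ℝ) (x : ι → ℝ) : ℝ := fderiv ℝ f x (Pi.single i 1)

/-- Christoffel symbol `Γ^k_{ij} = ½ g^{kl} (∂_i g_{jl} + ∂_j g_{il} - ∂_l g_{ij})`. -/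
def christoffel (g : (ι → ℝ) → Matrix ι ι ℝ) (k i j : ι) (x : ι → ℝ) : ℝ :=
  (1 / 2) * ∑ l, (g x)⁻¹ k l *
    (pd i (fun y => g y j l) x + pd j (fun y => g y i l) x - pd l (fun y => g y i j) x)

/-- Riemann tensor `R_{jkl}{}^m`, with the convention
`R_{jkl}{}^m = -∂_j Γ^m_{kl} + ∂_k Γ^m_{jl} + Γ^p_{jl} Γ^m_{kp} - Γ^p_{kl} Γ^m_{jp}`. -/
def riemann (g : (ι → ℝ) → Matrix ι ι ℝ) (j k l m : ι) (x : ι → ℝ) : ℝ :=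
  -pd j (christoffel g m k l) x + pd k (christoffel g m j l) x
    + ∑ p, (christoffel g p j l x * christoffel g m k p x
      - christoffel g p k l x * christoffel g m j p x)

/-- `R_{jklm} = R_{jkl}{}^p g_{pm}`. -/
def riemannLow (g : (ι → ℝ) → Matrix ι ι ℝ) (j k l m : ι) (x : ι → ℝ) : ℝ :=
  ∑ p, riemann g j k l p x * g x p m

/-- Ricci tensor
`R_{ij} = ∂_m Γ^m_{ij} - ∂_i Γ^m_{mj} + Γ^k_{ij} Γ^m_{km} - Γ^k_{im} Γ^m_{kj}`. -/
def ricci (g : (ι → ℝ) → Matrix ι ι ℝ) (x : ι → ℝ) (i j : ι) : ℝ :=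
  ∑ m, (pd m (christoffel g m i j) x - pd i (christoffel g m m j) x)
    + ∑ m, ∑ k, (christoffel g k i j x * christoffel g m k m x
      - christoffel g k i m x * christoffel g m k j x)

/-- Curvature scalar `R = g^{ij} R_{ij}`. -/
def scalarCurv (g : (ι → ℝ) → Matrix ι ι ℝ) (x : ι → ℝ) : ℝ :=
  ∑ i, ∑ j, (g x)⁻¹ i j * ricci g x i j

/-- Weyl tensor `C_{jklm}`. -/
def weyl (g : (ι → ℝ) → Matrix ι ι ℝ) (j k l m : ι) (x : ι → ℝ) : ℝ :=
  let n : ℝ := Fintype.card ι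
  riemannLow g j k l m x
    + (g x j m * ricci g x k l - g x k m * ricci g x j l
      + ricci g x j m * g x k l - ricci g x k m * g x j l) / (n - 2)
    - scalarCurv g x * (g x j m * g x k l - g x k m * g x j l) / ((n - 1) * (n - 2))

/-- Raised components `w^i = g^{ij} w_j` of a covector field. -/
def raise (g : (ι → ℝ) → Matrix ι ι ℝ) (w : (ι → ℝ) → ι → ℝ) (x : ι → ℝ) (i : ι) : ℝ :=
  ∑ j, (g x)⁻¹ i j * w x j

/-- Covariant derivative `∇_i w_j = ∂_i w_j - Γ^k_{ij} w_k` of a covector field. -/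
def covDeriv (g : (ι → ℝ) → Matrix ι ι ℝ) (w : (ι → ℝ) → ι → ℝ) (x : ι → ℝ) (i j : ι) : ℝ :=
  pd i (fun y => w y j) x - ∑ k, christoffel g k i j x * w x k

/-- Divergence `∇_p w^p = g^{ij} ∇_i w_j` of a covector field. -/
def divergence (g : (ι → ℝ) → Matrix ι ι ℝ) (w : (ι → ℝ) → ι → ℝ) (x : ι → ℝ) : ℝ :=
  ∑ i, ∑ j, (g x)⁻¹ i j * covDeriv g w x i j

/-- Directional derivative `w^k ∂_k f` of a scalar along a covector field. -/
def along (g : (ι → ℝ) → Matrix ι ι ℝ) (w : (ι → ℝ) → ι → ℝ) (f : (ι → ℝ) → ℝ)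
    (x : ι → ℝ) : ℝ :=
  ∑ k, raise g w x k * pd k f x

/-- The Einstein field equations `R_{ij} - ½ R g_{ij} = T_{ij}` on a region `D`. -/
def EinsteinEq (g T : (ι → ℝ) → Matrix ι ι ℝ) (D : Set (ι → ℝ)) : Prop :=
  ∀ x ∈ D, ∀ i j, ricci g x i j - (1 / 2) * scalarCurv g x * g x i j = T x i j

end ChartGeometry

open ChartGeometry

/-- Coordinate indices: time, radius, and `N` coordinates on the unit sphere `S_N`. -/
abbrev Idx (N : ℕ) : Type := Unit ⊕ (Unit ⊕ Fin N)

/-- The data of a spherical doubly warped metric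
`ds² = -b²(r) dt² + a²(t) [f₁²(r) dr² + f₂²(r) dΩ²_N]` of spacetime dimension `n = N + 2`,
with `t ∈ I` and `r ∈ J`. The unit sphere `S_N ⊂ ℝ^{N+1}` is described in arbitrary local coordinates
by a regular parametrization `Y : U → S_N`; `dΩ²_N` is the metric induced by `ℝ^{N+1}`. -/
structure SphericalDW (N : ℕ) where
  I : Set ℝ
  J : Set ℝ
  U : Set (Fin N → ℝ)
  a : ℝ → ℝ
  b : ℝ → ℝ
  f₁ : ℝ → ℝ
  f₂ : ℝ → ℝ
  Y : (Fin N → ℝ) → EuclideanSpace ℝ (Fin (N + 1))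
  isOpen_I : IsOpen I
  isOpen_J : IsOpen J
  isOpen_U : IsOpen U
  contDiff_a : ContDiffOn ℝ 2 a I
  contDiff_b : ContDiffOn ℝ 2 b J
  contDiff_f₁ : ContDiffOn ℝ 2 f₁ J
  contDiff_f₂ : ContDiffOn ℝ 2 f₂ J
  contDiff_Y : ContDiffOn ℝ ∞ Y U
  a_pos : ∀ t ∈ I, 0 < a t
  b_pos : ∀ r ∈ J, 0 < b r
  f₁_pos : ∀ r ∈ J, 0 < f₁ r
  f₂_pos : ∀ r ∈ J, 0 < f₂ r
  norm_Y : ∀ y ∈ U, ‖Y y‖ = 1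
  immersion_Y : ∀ y ∈ U, Function.Injective (fderiv ℝ Y y)

namespace SphericalDW

variable {N : ℕ} (S : SphericalDW N)

/-- The time coordinate of a point. -/
def time (x : Idx N → ℝ) : ℝ := x (Sum.inl ())

/-- The radial coordinate of a point. -/
def rad (x : Idx N → ℝ) : ℝ := x (Sum.inr (Sum.inl ()))

/-- The coordinates of a point on the sphere. -/
def ang (x : Idx N → ℝ) : Fin N → ℝ := fun c => x (Sum.inr (Sum.inr c))

/-- The coordinate domain of the spacetime. -/
def domain : Set (Idx N → ℝ) := {x | time x ∈ S.I ∧ rad x ∈ S.J ∧ ang x ∈ S.U}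

/-- The round metric of the unit sphere in the coordinates given by `Y`. -/
def sphereMetric (y : Fin N → ℝ) (c d : Fin N) : ℝ :=
  inner ℝ (fderiv ℝ S.Y y (Pi.single c 1)) (fderiv ℝ S.Y y (Pi.single d 1))

/-- The spacetime metric `g_{ij}`. -/
def metric (x : Idx N → ℝ) : Matrix (Idx N) (Idx N) ℝ := fun i j =>
  match i, j with
  | Sum.inl _, Sum.inl _ => -(S.b (rad x)) ^ 2
  | Sum.inr (Sum.inl _), Sum.inr (Sum.inl _) => S.a (time x) ^ 2 * S.f₁ (rad x) ^ 2
  | Sum.inr (Sum.inr c), Sum.inr (Sum.inr d) =>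
      S.a (time x) ^ 2 * (S.f₂ (rad x) ^ 2 * S.sphereMetric (ang x) c d)
  | _, _ => 0

/-- The comoving velocity `u_j`: `u_0 = -b`, `u_μ = 0`. -/
def u (x : Idx N → ℝ) : Idx N → ℝ := fun i =>
  match i with
  | Sum.inl _ => -S.b (rad x)
  | _ => 0

/-- The unit radial covector `N_i`: its only component is `N_r = a f₁`. -/
def radial (x : Idx N → ℝ) : Idx N → ℝ := fun i =>
  match i with
  | Sum.inr (Sum.inl _) => S.a (time x) * S.f₁ (rad x)
  | _ => 0

/-- The acceleration `u̇_j = u^k ∇_k u_j`. -/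
def accel (x : Idx N → ℝ) : Idx N → ℝ := fun j =>
  ∑ k, raise S.metric S.u x k * covDeriv S.metric S.u x k j

/-- The spacetime dimension `n = N + 2`, as a real number. -/
def dim (_S : SphericalDW N) : ℝ := N + 2

/-- `φ = ∇_j u^j / (n - 1)`. -/
def phi (x : Idx N → ℝ) : ℝ := divergence S.metric S.u x / (S.dim - 1)

/-- `ξ = (n - 1) (φ² + φ̇)`, where `φ̇ = u^k ∂_k φ`. -/
def xi (x : Idx N → ℝ) : ℝ := (S.dim - 1) * (S.phi x ^ 2 + along S.metric S.u S.phi x)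

/-- `η = u̇_i u̇^i`. -/
def eta (x : Idx N → ℝ) : ℝ := ∑ i, S.accel x i * raise S.metric S.accel x i

/-- `h_{jk} = g_{jk} + u_j u_k`. -/
def h (x : Idx N → ℝ) (j k : Idx N) : ℝ := S.metric x j k + S.u x j * S.u x k

/-- `h^{jk} = g^{jk} + u^j u^k`. -/
def hUp (x : Idx N → ℝ) (j k : Idx N) : ℝ :=
  (S.metric x)⁻¹ j k + raise S.metric S.u x j * raise S.metric S.u x k

/-- The mixed projector `h_j{}^k = δ_j^k + u_j u^k`. -/
def hMix (x : Idx N → ℝ) (j k : Idx N) : ℝ :=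
  (if j = k then 1 else 0) + S.u x j * raise S.metric S.u x k

/-- The divergence `∇_p u̇^p` of the acceleration. -/
def divAccel (x : Idx N → ℝ) : ℝ := divergence S.metric S.accel x

/-- The electric tensor `E_{kl} = u^j u^m C_{jklm}`. -/
def electric (x : Idx N → ℝ) (k l : Idx N) : ℝ :=
  ∑ j, ∑ m, raise S.metric S.u x j * raise S.metric S.u x m * weyl S.metric j k l m x

/-- `E(r) = (n-3)/(n-2) · 1/f₁² · [f₁²/f₂² + (log f₂)'' - f₁' f₂' / (f₁ f₂)
+ (b'/b) (log (f₁ f₂))' - b''/b]`. -/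
def E (r : ℝ) : ℝ :=
  (S.dim - 3) / (S.dim - 2) * (1 / S.f₁ r ^ 2) *
    (S.f₁ r ^ 2 / S.f₂ r ^ 2
      + deriv (deriv fun s => Real.log (S.f₂ s)) r
      - deriv S.f₁ r * deriv S.f₂ r / (S.f₁ r * S.f₂ r)
      + deriv S.b r / S.b r * deriv (fun s => Real.log (S.f₁ s * S.f₂ s)) r
      - deriv (deriv S.b) r / S.b r)

/-- The contribution `∇_p u̇^p - (n-1) (η + u̇^i ∇_i η / (2η))` of the acceleration to the
anisotropy. -/
def accelAnisotropy (x : Idx N → ℝ) : ℝ :=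
  S.divAccel x - (S.dim - 1) * (S.eta x + along S.metric S.accel S.eta x / (2 * S.eta x))

/-! ### Fluid quantities of an energy-momentum tensor, measured by the observers `u` -/

variable (T : (Idx N → ℝ) → Matrix (Idx N) (Idx N) ℝ)

/-- Energy density `μ = T_{ij} u^i u^j`. -/
def energyDensity (x : Idx N → ℝ) : ℝ :=
  ∑ i, ∑ j, T x i j * raise S.metric S.u x i * raise S.metric S.u x j

/-- Effective pressure `P = h^{ij} T_{ij} / (n - 1)`. -/
def pressure (x : Idx N → ℝ) : ℝ := (∑ i, ∑ j, S.hUp x i j * T x i j) / (S.dim - 1)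

/-- Heat flux `q_j = -h_j{}^k T_{kl} u^l`. -/
def heatFlux (x : Idx N → ℝ) (j : Idx N) : ℝ :=
  -∑ k, ∑ l, S.hMix x j k * T x k l * raise S.metric S.u x l

/-- Radial pressure `p_r = T_{ij} N^i N^j`. -/
def radialPressure (x : Idx N → ℝ) : ℝ :=
  ∑ i, ∑ j, T x i j * raise S.metric S.radial x i * raise S.metric S.radial x j

/-- Tangential pressure `p_⊥ = (h^{ij} - N^i N^j) T_{ij} / (n - 2)`. -/
def tangentialPressure (x : Idx N → ℝ) : ℝ :=
  (∑ i, ∑ j, (S.hUp x i j - raise S.metric S.radial x i * raise S.metric S.radial x j) * T x i j)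
    / (S.dim - 2)

end SphericalDW

end

noncomputable section

open ChartGeometry Filter Topology

/-! ### Partial derivatives and Christoffel symbols in a chart -/

namespace ChartGeometry

/-! The theorem is a chart computation made tractable by three observations. The sphere has
arbitrary coordinates, so its curvature is obtained extrinsically: the `gauss_formula` splits the
second derivatives of `Y` into tangential and normal parts, and commuting third derivatives gives
constant curvature one (`gauss_equation`), hence Ricci equal to `(N - 1)` times the round metric.
Every Christoffel symbol of the spacetime is a product of a function of time, one of the radius and
one of the angles (`christoffel_metric`), so the curvature is differentiated factor by factor
(`ricci_metric`, `riemann_time_time`). By symmetry the Ricci tensor has the form `α uu + β (uN + Nu)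
+ γ NN + δ (h - NN)` (`ricci_eq_frameTensor`). With `u̇ = A N`, the tensor formulas reduce to scalar
ones: `α = -ξ + ∇u̇` (`ricciUU_eq`), `β = -(n-2) φ A`, `R = -α + γ + N δ`, and the value of `γ - δ`
in terms of `E` (`ricciNN_sub_ricciTan` and its geodesic variant). Since `g = -uu + NN + (h - NN)`,
the Einstein equations shift `α` by `R/2` and both `γ` and `δ` by `-R/2`; the fluid quantities are
then read off from the coefficients. The electric tensor needs in addition only the components
`R_{0kl0}`. -/

theorem pd_congr {ι : Type} [DecidableEq ι] {f g : (ι → ℝ) → ℝ} {x : ι → ℝ}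
    (h : f =ᶠ[𝓝 x] g) (i : ι) : pd i f x = pd i g x := by
  rw [pd, h.fderiv_eq, pd]

theorem pd_const {ι : Type} [DecidableEq ι] (i : ι) (c : ℝ) (x : ι → ℝ) :
    pd i (fun _ => c) x = 0 := by
  simp [pd]

theorem christoffel_symm {ι : Type} [Fintype ι] [DecidableEq ι]
    {g : (ι → ℝ) → Matrix ι ι ℝ} (hg : ∀ x i j, g x i j = g x j i)
    (k i j : ι) (x : ι → ℝ) : christoffel g k i j x = christoffel g k j i x := by
  unfold christoffel
  simp only [fun y => hg y j i]
  congr 1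
  refine Finset.sum_congr rfl fun l _ => ?_
  ring

end ChartGeometry

/-! ### The round sphere in arbitrary coordinates, as a hypersurface -/

namespace SphericalDW

variable {N : ℕ} (S : SphericalDW N)

/-- The coordinate tangent vector `∂_c Y` of the sphere. -/
def tangent (c : Fin N) (y : Fin N → ℝ) : EuclideanSpace ℝ (Fin (N + 1)) :=
  fderiv ℝ S.Y y (Pi.single c 1)

/-- The second derivative `∂_c ∂_d Y`. -/
def second (c d : Fin N) (y : Fin N → ℝ) : EuclideanSpace ℝ (Fin (N + 1)) :=
  fderiv ℝ (S.tangent d) y (Pi.single c 1)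

/-- The round metric as a matrix-valued function. -/
def sphereGram (y : Fin N → ℝ) : Matrix (Fin N) (Fin N) ℝ :=
  Matrix.of fun c d => S.sphereMetric y c d

theorem sphereGram_apply (y : Fin N → ℝ) (c d : Fin N) :
    S.sphereGram y c d = S.sphereMetric y c d := rfl

variable {S} {y : Fin N → ℝ}

theorem contDiffAt_Y (hy : y ∈ S.U) : ContDiffAt ℝ ∞ S.Y y :=
  S.contDiff_Y.contDiffAt (S.isOpen_U.mem_nhds hy)

theorem contDiffAt_tangent (hy : y ∈ S.U) (c : Fin N) : ContDiffAt ℝ ∞ (S.tangent c) y :=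
  ((contDiffAt_Y hy).fderiv_right (m := ∞) (by simp)).clm_apply contDiffAt_const

theorem contDiffAt_second (hy : y ∈ S.U) (c d : Fin N) : ContDiffAt ℝ ∞ (S.second c d) y :=
  ((contDiffAt_tangent hy d).fderiv_right (m := ∞) (by simp)).clm_apply contDiffAt_const

theorem contDiffAt_sphereMetric (hy : y ∈ S.U) (c d : Fin N) :
    ContDiffAt ℝ ∞ (fun y => S.sphereMetric y c d) y :=
  (contDiffAt_tangent hy c).inner ℝ (contDiffAt_tangent hy d)

/-- Used for `Y`, to make `second` symmetric, and for `tangent`, where it is the integrability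
condition behind the Gauss equation. -/
theorem fderiv_fderiv_apply_comm {F : Type*} [NormedAddCommGroup F] [NormedSpace ℝ F]
    {f : (Fin N → ℝ) → F} (hf : ContDiffAt ℝ ∞ f y) (v w : Fin N → ℝ) :
    fderiv ℝ (fun z => fderiv ℝ f z v) y w = fderiv ℝ (fun z => fderiv ℝ f z w) y v := by
  have hd : DifferentiableAt ℝ (fderiv ℝ f) y :=
    (hf.fderiv_right (m := 1) (by norm_cast)).differentiableAt (by simp)
  have key := (hf.isSymmSndFDerivAt (by simp; norm_cast)).eq w v
  rw [fderiv_clm_apply hd (by fun_prop), fderiv_clm_apply hd (by fun_prop)]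
  simpa using key

theorem second_symm (hy : y ∈ S.U) (c d : Fin N) : S.second c d y = S.second d c y :=
  fderiv_fderiv_apply_comm (contDiffAt_Y hy) _ _

theorem inner_tangent_Y (hy : y ∈ S.U) (c : Fin N) : inner ℝ (S.tangent c y) (S.Y y) = 0 := by
  have h1 : (fun z => inner ℝ (S.Y z) (S.Y z)) =ᶠ[𝓝 y] fun _ => (1 : ℝ) := by
    filter_upwards [S.isOpen_U.mem_nhds hy] with z hz
    rw [real_inner_self_eq_norm_sq, S.norm_Y z hz, one_pow]
  have hd : DifferentiableAt ℝ S.Y y := (contDiffAt_Y hy).differentiableAt (by simp)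
  have h2 := congrArg (fun L : (Fin N → ℝ) →L[ℝ] ℝ => L (Pi.single c 1)) h1.fderiv_eq
  simp only [fderiv_inner_apply ℝ hd hd] at h2
  rw [real_inner_comm (S.Y y)] at h2
  simp at h2
  rw [real_inner_comm] at h2
  exact h2

theorem inner_Y_tangent (hy : y ∈ S.U) (c : Fin N) : inner ℝ (S.Y y) (S.tangent c y) = 0 := by
  rw [real_inner_comm, inner_tangent_Y hy]

/-- Differentiating `⟨Y, ∂_d Y⟩ = 0`, valid near `y`, gives the second fundamental form of the unit
sphere. -/
theorem inner_second_Y (hy : y ∈ S.U) (c d : Fin N) :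
    inner ℝ (S.second c d y) (S.Y y) = -S.sphereMetric y c d := by
  have h1 : (fun z => inner ℝ (S.Y z) (S.tangent d z)) =ᶠ[𝓝 y] fun _ => (0 : ℝ) := by
    filter_upwards [S.isOpen_U.mem_nhds hy] with z hz
    exact inner_Y_tangent hz d
  have hd : DifferentiableAt ℝ S.Y y := (contDiffAt_Y hy).differentiableAt (by simp)
  have hd' := (contDiffAt_tangent hy d).differentiableAt (by simp)
  have h2 := congrArg (fun L : (Fin N → ℝ) →L[ℝ] ℝ => L (Pi.single c 1)) h1.fderiv_eq
  simp only [fderiv_inner_apply ℝ hd hd'] at h2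
  rw [real_inner_comm]
  simp only [fderiv_const_apply, zero_apply] at h2
  change inner ℝ (S.Y y) (S.second c d y) + S.sphereMetric y c d = 0 at h2
  linarith

theorem linearIndependent_tangent (hy : y ∈ S.U) :
    LinearIndependent ℝ (fun c => S.tangent c y) := by
  have h := (Pi.basisFun ℝ (Fin N)).linearIndependent.map' (fderiv ℝ S.Y y).toLinearMap
    (LinearMap.ker_eq_bot.2 (S.immersion_Y y hy))
  have e : (fun c => S.tangent c y) =
      (fderiv ℝ S.Y y).toLinearMap ∘ Pi.basisFun ℝ (Fin N) := by
    ext c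
    simp [tangent]
  rw [e]
  exact h

/-- A unit vector orthogonal to all tangents would otherwise be orthogonal to itself. -/
theorem Y_notMem_span (hy : y ∈ S.U) :
    S.Y y ∉ Submodule.span ℝ (Set.range fun c => S.tangent c y) := by
  intro h
  have hle : Submodule.span ℝ (Set.range fun c => S.tangent c y) ≤
      (Submodule.span ℝ {S.Y y})ᗮ := by
    rw [Submodule.span_le]
    rintro _ ⟨c, rfl⟩
    exact (Submodule.mem_orthogonal_singleton_iff_inner_right).2 (inner_Y_tangent hy c)
  have := (Submodule.mem_orthogonal_singleton_iff_inner_right).1 (hle h)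
  rw [real_inner_self_eq_norm_sq, S.norm_Y y hy] at this
  norm_num at this

/-- `Y` and the `N` tangents are `N + 1` independent vectors of `ℝ^{N+1}`, hence a basis. Vector
identities can therefore be tested by inner products alone. -/
theorem eq_zero_of_inner (hy : y ∈ S.U) {v : EuclideanSpace ℝ (Fin (N + 1))}
    (hv : ∀ c, inner ℝ v (S.tangent c y) = 0) (hY : inner ℝ v (S.Y y) = 0) : v = 0 := by
  have hli := (linearIndependent_tangent hy).finCons (Y_notMem_span hy)
  have htop := hli.span_eq_top_of_card_eq_finrank (by simp)
  have hle : Submodule.span ℝ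
      (Set.range (Fin.cons (S.Y y) fun c => S.tangent c y : Fin (N + 1) → _)) ≤
      (Submodule.span ℝ {v})ᗮ := by
    rw [Submodule.span_le]
    rintro _ ⟨c, rfl⟩
    refine (Submodule.mem_orthogonal_singleton_iff_inner_right).2 ?_
    refine Fin.cases ?_ (fun c => ?_) c
    · simpa using hY
    · simpa using hv c
  rw [htop] at hle
  exact inner_self_eq_zero.1
    ((Submodule.mem_orthogonal_singleton_iff_inner_right).1 (hle (Submodule.mem_top (x := v))))

theorem sphereMetric_symm (y : Fin N → ℝ) (c d : Fin N) :
    S.sphereMetric y c d = S.sphereMetric y d c := real_inner_comm _ _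

/-- If two vectors have the same image under the Gram matrix, the tangent combination of their
difference is orthogonal to all tangents and to `Y`, so it vanishes, and independence finishes. -/
theorem isUnit_det_sphereMetric (hy : y ∈ S.U) :
    IsUnit (S.sphereGram y).det := by
  rw [← Matrix.isUnit_iff_isUnit_det, ← Matrix.mulVec_injective_iff_isUnit]
  intro v w hvw
  have hl := Fintype.linearIndependent_iff.1 (linearIndependent_tangent hy) (v - w) ?_
  · ext c
    exact sub_eq_zero.1 (hl c)
  · refine eq_zero_of_inner hy (fun c => ?_) ?_
    · have := congrFun hvw c
      simp only [Matrix.mulVec, dotProduct] at this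
      rw [sum_inner]
      simp only [inner_smul_left]
      simp only [Pi.sub_apply, conj_trivial, sub_mul, Finset.sum_sub_distrib, sub_eq_zero]
      have e : ∀ k (t : ℝ), t * inner ℝ (S.tangent k y) (S.tangent c y) = S.sphereGram y c k * t :=
        fun k t => by
          rw [real_inner_comm, mul_comm]
          rfl
      simpa only [e] using this
    · rw [sum_inner]
      refine Finset.sum_eq_zero fun c _ => ?_
      rw [inner_smul_left, real_inner_comm, inner_Y_tangent hy, mul_zero]

theorem sum_inv_mul_sphereMetric (hy : y ∈ S.U) (c d : Fin N) :
    ∑ e, (S.sphereGram y)⁻¹ c e * S.sphereMetric y e d =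
      if c = d then 1 else 0 := by
  have := Matrix.nonsing_inv_mul (S.sphereGram y) (isUnit_det_sphereMetric hy)
  have h := congrFun (congrFun this c) d
  rw [Matrix.mul_apply, Matrix.one_apply] at h
  exact h

theorem sum_sphereMetric_mul_inv (hy : y ∈ S.U) (c d : Fin N) :
    ∑ e, S.sphereMetric y c e * (S.sphereGram y)⁻¹ e d =
      if c = d then 1 else 0 := by
  have := Matrix.mul_nonsing_inv (S.sphereGram y) (isUnit_det_sphereMetric hy)
  have h := congrFun (congrFun this c) d
  rw [Matrix.mul_apply, Matrix.one_apply] at h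
  exact h

theorem pd_sphereMetric (hy : y ∈ S.U) (c d e : Fin N) :
    pd c (fun y => S.sphereMetric y d e) y =
      inner ℝ (S.second c d y) (S.tangent e y) + inner ℝ (S.tangent d y) (S.second c e y) := by
  have hd := (contDiffAt_tangent hy d).differentiableAt (by simp)
  have he := (contDiffAt_tangent hy e).differentiableAt (by simp)
  rw [add_comm]
  exact fderiv_inner_apply ℝ hd he _

/-- Of the six inner products in the Koszul combination, four cancel by symmetry of `second` and the
other two coincide. -/
theorem christoffel_sphereMetric (hy : y ∈ S.U) (k i j : Fin N) :
    christoffel S.sphereGram k i j y =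
      ∑ l, (S.sphereGram y)⁻¹ k l *
        inner ℝ (S.second i j y) (S.tangent l y) := by
  rw [christoffel, Finset.mul_sum]
  simp only [sphereGram_apply]
  refine Finset.sum_congr rfl fun l _ => ?_
  rw [pd_sphereMetric hy, pd_sphereMetric hy, pd_sphereMetric hy, second_symm hy j i,
    second_symm hy l i, second_symm hy l j, real_inner_comm (S.second i l y)]
  ring

theorem gauss_formula (hy : y ∈ S.U) (i j : Fin N) :
    S.second i j y = ∑ k, christoffel S.sphereGram k i j y • S.tangent k y
      - S.sphereMetric y i j • S.Y y := by
  rw [← sub_eq_zero]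
  refine eq_zero_of_inner hy (fun c => ?_) ?_
  · rw [inner_sub_left, inner_sub_left, sum_inner, inner_smul_left, inner_Y_tangent hy]
    simp only [inner_smul_left, conj_trivial]
    have : ∀ k, inner ℝ (S.tangent k y) (S.tangent c y) = S.sphereMetric y c k := fun k =>
      (sphereMetric_symm y k c)
    simp only [this, christoffel_sphereMetric hy, Finset.sum_mul]
    rw [Finset.sum_comm]
    have h2 : ∀ l, ∑ k, (S.sphereGram y)⁻¹ k l *
        inner ℝ (S.second i j y) (S.tangent l y) * S.sphereMetric y c k
        = (if c = l then 1 else 0) * inner ℝ (S.second i j y) (S.tangent l y) := by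
      intro l
      rw [← sum_sphereMetric_mul_inv hy, Finset.sum_mul]
      exact Finset.sum_congr rfl fun k _ => by ring
    simp only [h2]
    simp
  · rw [inner_sub_left, inner_sub_left, sum_inner, inner_smul_left, inner_second_Y hy,
      real_inner_self_eq_norm_sq, S.norm_Y y hy]
    simp [inner_smul_left, inner_tangent_Y hy]

/-- By Cramer's rule an entry of the inverse is a quotient of determinants, which are polynomial in
the metric components. -/
theorem differentiableAt_inv_sphereMetric (hy : y ∈ S.U) (k l : Fin N) :
    DifferentiableAt ℝ (fun z => (S.sphereGram z)⁻¹ k l) y := by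
  have hdet : ∀ M : (Fin N → ℝ) → Matrix (Fin N) (Fin N) ℝ,
      (∀ i j, DifferentiableAt ℝ (fun z => M z i j) y) →
      DifferentiableAt ℝ (fun z => (M z).det) y := by
    intro M hM
    simp only [Matrix.det_apply]
    fun_prop
  have hσ : ∀ i j, DifferentiableAt ℝ (fun z => S.sphereMetric z i j) y := fun i j =>
    (contDiffAt_sphereMetric hy i j).differentiableAt (by simp)
  have : (fun z => (S.sphereGram z)⁻¹ k l) = fun z =>
      (S.sphereGram z).det⁻¹ *
        ((S.sphereGram z).updateRow l (Pi.single k 1)).det := by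
    ext z
    rw [Matrix.inv_def, Ring.inverse_eq_inv', Matrix.smul_apply, Matrix.adjugate_apply, smul_eq_mul]
  rw [this]
  refine (DifferentiableAt.inv (hdet _ hσ) (isUnit_det_sphereMetric hy).ne_zero).mul
    (hdet _ fun i j => ?_)
  simp only [Matrix.updateRow_apply]
  split_ifs
  · exact differentiableAt_const _
  · exact hσ i j

theorem differentiableAt_christoffel_sphereMetric (hy : y ∈ S.U) (k i j : Fin N) :
    DifferentiableAt ℝ (christoffel S.sphereGram k i j) y := by
  have : christoffel S.sphereGram k i j =ᶠ[𝓝 y] fun z =>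
      ∑ l, (S.sphereGram z)⁻¹ k l *
        inner ℝ (S.second i j z) (S.tangent l z) := by
    filter_upwards [S.isOpen_U.mem_nhds hy] with z hz
    exact christoffel_sphereMetric hz k i j
  refine this.differentiableAt_iff.2 (DifferentiableAt.fun_sum fun l _ => ?_)
  exact (differentiableAt_inv_sphereMetric hy k l).mul
    (((contDiffAt_second hy i j).differentiableAt (by simp)).inner ℝ
      ((contDiffAt_tangent hy l).differentiableAt (by simp)))

/-- The Gauss formula is differentiated and then applied again to each `∂_c ∂_k Y`. The term with
`if k = c` comes from differentiating the normal `Y` itself. -/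
theorem fderiv_second (hy : y ∈ S.U) (c i j : Fin N) :
    fderiv ℝ (S.second i j) y (Pi.single c 1) =
      ∑ k, (pd c (christoffel S.sphereGram k i j) y +
        ∑ p, christoffel S.sphereGram p i j y * christoffel S.sphereGram k c p y
          - S.sphereMetric y i j * if k = c then 1 else 0) • S.tangent k y
      - (∑ p, christoffel S.sphereGram p i j y * S.sphereMetric y c p
        + pd c (fun y => S.sphereMetric y i j) y) • S.Y y := by
  have h : S.second i j =ᶠ[𝓝 y] fun z => ∑ k, christoffel S.sphereGram k i j z • S.tangent k z
      - S.sphereMetric z i j • S.Y z := by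
    filter_upwards [S.isOpen_U.mem_nhds hy] with z hz
    exact gauss_formula hz i j
  have hY : DifferentiableAt ℝ S.Y y := (contDiffAt_Y hy).differentiableAt (by simp)
  have hσ := (contDiffAt_sphereMetric hy i j).differentiableAt (by simp)
  have hΓ := fun k => differentiableAt_christoffel_sphereMetric hy k i j
  have ht := fun k => (contDiffAt_tangent hy k).differentiableAt (by simp)
  have hD : HasFDerivAt (S.second i j) _ y := ((HasFDerivAt.fun_sum (u := Finset.univ) fun k _ =>
    (hΓ k).hasFDerivAt.smul (ht k).hasFDerivAt).sub (hσ.hasFDerivAt.smul hY.hasFDerivAt)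
      ).congr_of_eventuallyEq h
  rw [hD.fderiv]
  have e1 : ∀ k, fderiv ℝ (S.tangent k) y (Pi.single c 1) = S.second c k y := fun _ => rfl
  have e2 : fderiv ℝ S.Y y (Pi.single c 1) = S.tangent c y := rfl
  have e3 : ∀ k, fderiv ℝ (christoffel S.sphereGram k i j) y (Pi.single c 1) =
    pd c (christoffel S.sphereGram k i j) y := fun _ => rfl
  have e4 : fderiv ℝ (fun y => S.sphereMetric y i j) y (Pi.single c 1) =
    pd c (fun y => S.sphereMetric y i j) y := rfl
  simp only [sub_apply, sum_apply,
    add_apply, smul_apply,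
    ContinuousLinearMap.smulRight_apply, e1, e2, e3, e4, gauss_formula hy]
  simp only [add_smul, sub_smul, Finset.sum_add_distrib, Finset.sum_sub_distrib, smul_sub,
    Finset.smul_sum, Finset.sum_smul, smul_smul]
  rw [Finset.sum_comm]
  simp
  abel

/-- Third derivatives of `Y` commute, so the tangential coefficients of the two expansions agree. -/
theorem gauss_equation (hy : y ∈ S.U) (c d j f : Fin N) :
    pd c (christoffel S.sphereGram f d j) y - pd d (christoffel S.sphereGram f c j) y
      + ∑ p, (christoffel S.sphereGram p d j y * christoffel S.sphereGram f c p y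
        - christoffel S.sphereGram p c j y * christoffel S.sphereGram f d p y)
      = S.sphereMetric y d j * (if f = c then 1 else 0)
        - S.sphereMetric y c j * (if f = d then 1 else 0) := by
  have h : fderiv ℝ (S.second d j) y (Pi.single c 1) = fderiv ℝ (S.second c j) y (Pi.single d 1) :=
    fderiv_fderiv_apply_comm (contDiffAt_tangent hy j) _ _
  rw [fderiv_second hy, fderiv_second hy] at h
  have hli := (linearIndependent_tangent hy).finCons (Y_notMem_span hy)
  -- Slot zero holds the normal (Codazzi) coefficient, which is not needed; the tangential
  -- coefficient is extracted at `f.succ`.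
  have := Fintype.linearIndependent_iff.1 hli (Fin.cons
    (-(∑ p, christoffel S.sphereGram p d j y * S.sphereMetric y c p
        + pd c (fun y => S.sphereMetric y d j) y)
      + (∑ p, christoffel S.sphereGram p c j y * S.sphereMetric y d p
        + pd d (fun y => S.sphereMetric y c j) y)) fun k =>
    (pd c (christoffel S.sphereGram k d j) y +
        ∑ p, christoffel S.sphereGram p d j y * christoffel S.sphereGram k c p y
          - S.sphereMetric y d j * if k = c then 1 else 0)
    - (pd d (christoffel S.sphereGram k c j) y +
        ∑ p, christoffel S.sphereGram p c j y * christoffel S.sphereGram k d p y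
          - S.sphereMetric y c j * if k = d then 1 else 0)) ?_ f.succ
  · rw [Fin.cons_succ] at this
    rw [Finset.sum_sub_distrib]
    linarith
  · rw [Fin.sum_univ_succ]
    simp only [Fin.cons_zero, Fin.cons_succ]
    rw [← sub_eq_zero] at h
    rw [← h, Finset.sum_congr rfl fun k _ => sub_smul _ _ (S.tangent k y), Finset.sum_sub_distrib]
    module

/-- Contraction of the Gauss equation: the two Kronecker terms contribute `N` and `-1`. -/
theorem ricci_sphereMetric (hy : y ∈ S.U) (i j : Fin N) :
    ricci S.sphereGram y i j = (N - 1) * S.sphereMetric y i j := by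
  have h : ricci S.sphereGram y i j = ∑ m, (S.sphereMetric y i j * (if m = m then 1 else 0)
        - S.sphereMetric y m j * (if m = i then 1 else 0)) := by
    rw [← Finset.sum_congr rfl fun m _ => gauss_equation hy m i j m, Finset.sum_add_distrib, ricci]
    congr 1
    simp only [Finset.sum_sub_distrib]
    congr 1
    · refine Finset.sum_congr rfl fun m _ => Finset.sum_congr rfl fun k _ => ?_
      rw [christoffel_symm (g := S.sphereGram) sphereMetric_symm m k m]
    · rw [Finset.sum_comm]
      refine Finset.sum_congr rfl fun m _ => Finset.sum_congr rfl fun k _ => ?_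
      rw [mul_comm]
  rw [h]
  simp [Finset.sum_sub_distrib]
  ring

end SphericalDW

/-! ### Functions separated in time, radius and angles -/

namespace SphericalDW

variable {N : ℕ}

/-- The product of a function of time, a function of the radius and a function on the sphere. -/
def sep (p q : ℝ → ℝ) (s : (Fin N → ℝ) → ℝ) (x : Idx N → ℝ) : ℝ :=
  p (time x) * q (rad x) * s (ang x)

section sep

variable {p q : ℝ → ℝ} {s : (Fin N → ℝ) → ℝ} {x : Idx N → ℝ}

/-- The three coordinate maps are linear, so they serve as their own derivatives; keeping `i`
general leaves only their values on a basis vector for the three special cases. -/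
theorem pd_sep (hp : DifferentiableAt ℝ p (time x)) (hq : DifferentiableAt ℝ q (rad x))
    (hs : DifferentiableAt ℝ s (ang x)) (i : Idx N) :
    pd i (sep p q s) x =
      deriv p (time x) * time (Pi.single i 1 : Idx N → ℝ) * q (rad x) * s (ang x)
      + p (time x) * (deriv q (rad x) * rad (Pi.single i 1 : Idx N → ℝ)) * s (ang x)
      + p (time x) * q (rad x) * fderiv ℝ s (ang x) (ang (Pi.single i 1 : Idx N → ℝ)) := by
  let Lt : (Idx N → ℝ) →L[ℝ] ℝ := ContinuousLinearMap.proj (Sum.inl ())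
  let Lr : (Idx N → ℝ) →L[ℝ] ℝ := ContinuousLinearMap.proj (Sum.inr (Sum.inl ()))
  let La : (Idx N → ℝ) →L[ℝ] (Fin N → ℝ) :=
    ContinuousLinearMap.pi fun c : Fin N => ContinuousLinearMap.proj (Sum.inr (Sum.inr c))
  have ht : HasFDerivAt time Lt x := Lt.hasFDerivAt
  have hr : HasFDerivAt rad Lr x := Lr.hasFDerivAt
  have ha : HasFDerivAt ang La x := La.hasFDerivAt
  have h : HasFDerivAt (sep p q s) _ x :=
    ((hp.hasDerivAt.comp_hasFDerivAt x ht).mul (hq.hasDerivAt.comp_hasFDerivAt x hr)).mul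
      (hs.hasFDerivAt.comp x ha)
  rw [pd, h.fderiv]
  have et : Lt (Pi.single i 1) = time (Pi.single i 1 : Idx N → ℝ) := rfl
  have er : Lr (Pi.single i 1) = rad (Pi.single i 1 : Idx N → ℝ) := rfl
  have ea : La (Pi.single i 1) = ang (Pi.single i 1 : Idx N → ℝ) := rfl
  simp only [add_apply, smul_apply, ContinuousLinearMap.comp_apply, Pi.mul_apply, et, er, ea,
    smul_eq_mul, Function.comp_apply]
  ring

theorem pd_time_sep (hp : DifferentiableAt ℝ p (time x)) (hq : DifferentiableAt ℝ q (rad x))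
    (hs : DifferentiableAt ℝ s (ang x)) (o : Unit) :
    pd (Sum.inl o) (sep p q s) x = deriv p (time x) * q (rad x) * s (ang x) := by
  have e : ang (Pi.single (Sum.inl o) 1 : Idx N → ℝ) = 0 := by ext; simp [ang]
  rw [pd_sep hp hq hs, e]
  simp [time, rad]

theorem pd_rad_sep (hp : DifferentiableAt ℝ p (time x)) (hq : DifferentiableAt ℝ q (rad x))
    (hs : DifferentiableAt ℝ s (ang x)) (o : Unit) :
    pd (Sum.inr (Sum.inl o)) (sep p q s) x = p (time x) * deriv q (rad x) * s (ang x) := by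
  have e : ang (Pi.single (Sum.inr (Sum.inl o)) 1 : Idx N → ℝ) = 0 := by ext; simp [ang]
  rw [pd_sep hp hq hs, e]
  simp [time, rad]

theorem pd_ang_sep (hp : DifferentiableAt ℝ p (time x)) (hq : DifferentiableAt ℝ q (rad x))
    (hs : DifferentiableAt ℝ s (ang x)) (c : Fin N) :
    pd (Sum.inr (Sum.inr c)) (sep p q s) x = p (time x) * q (rad x) * pd c s (ang x) := by
  have e : ang (Pi.single (Sum.inr (Sum.inr c)) 1 : Idx N → ℝ) = Pi.single c 1 := by
    ext d; simp [ang, Pi.single_apply]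
  rw [pd_sep hp hq hs, e]
  simp [time, rad, pd]

end sep

variable {S : SphericalDW N} {x : Idx N → ℝ}

theorem isOpen_domain (S : SphericalDW N) : IsOpen S.domain := by
  have ht : Continuous fun x : Idx N → ℝ => time x := by unfold time; fun_prop
  have hr : Continuous fun x : Idx N → ℝ => rad x := by unfold rad; fun_prop
  have ha : Continuous fun x : Idx N → ℝ => ang x := by unfold ang; fun_prop
  exact (S.isOpen_I.preimage ht).inter ((S.isOpen_J.preimage hr).inter (S.isOpen_U.preimage ha))

/-- Two functions that agree on the domain of the chart have the same partial derivatives there. -/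
theorem pd_congr_domain (hx : x ∈ S.domain) {f g : (Idx N → ℝ) → ℝ}
    (h : ∀ y ∈ S.domain, f y = g y) (i : Idx N) : pd i f x = pd i g x :=
  pd_congr (by filter_upwards [S.isOpen_domain.mem_nhds hx] with y hy using h y hy) i

theorem differentiableAt_of_contDiffOn {f : ℝ → ℝ} {s : Set ℝ} (hs : IsOpen s)
    (hf : ContDiffOn ℝ 2 f s) {t : ℝ} (ht : t ∈ s) : DifferentiableAt ℝ f t :=
  (hf.contDiffAt (hs.mem_nhds ht)).differentiableAt (by simp)

theorem differentiableAt_deriv_of_contDiffOn {f : ℝ → ℝ} {s : Set ℝ} (hs : IsOpen s)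
    (hf : ContDiffOn ℝ 2 f s) {t : ℝ} (ht : t ∈ s) : DifferentiableAt ℝ (deriv f) t := by
  have h1 : ContDiffOn ℝ 1 (deriv f) s := hf.deriv_of_isOpen hs (by norm_num)
  exact (h1.contDiffAt (hs.mem_nhds ht)).differentiableAt (by simp)

section regularity

variable {t r : ℝ}

theorem hasDerivAt_a (ht : t ∈ S.I) : HasDerivAt S.a (deriv S.a t) t :=
  (differentiableAt_of_contDiffOn S.isOpen_I S.contDiff_a ht).hasDerivAt

theorem hasDerivAt_deriv_a (ht : t ∈ S.I) : HasDerivAt (deriv S.a) (deriv (deriv S.a) t) t :=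
  (differentiableAt_deriv_of_contDiffOn S.isOpen_I S.contDiff_a ht).hasDerivAt

theorem hasDerivAt_b (hr : r ∈ S.J) : HasDerivAt S.b (deriv S.b r) r :=
  (differentiableAt_of_contDiffOn S.isOpen_J S.contDiff_b hr).hasDerivAt

theorem hasDerivAt_deriv_b (hr : r ∈ S.J) : HasDerivAt (deriv S.b) (deriv (deriv S.b) r) r :=
  (differentiableAt_deriv_of_contDiffOn S.isOpen_J S.contDiff_b hr).hasDerivAt

theorem hasDerivAt_f₁ (hr : r ∈ S.J) : HasDerivAt S.f₁ (deriv S.f₁ r) r :=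
  (differentiableAt_of_contDiffOn S.isOpen_J S.contDiff_f₁ hr).hasDerivAt

theorem hasDerivAt_deriv_f₁ (hr : r ∈ S.J) : HasDerivAt (deriv S.f₁) (deriv (deriv S.f₁) r) r :=
  (differentiableAt_deriv_of_contDiffOn S.isOpen_J S.contDiff_f₁ hr).hasDerivAt

theorem hasDerivAt_f₂ (hr : r ∈ S.J) : HasDerivAt S.f₂ (deriv S.f₂ r) r :=
  (differentiableAt_of_contDiffOn S.isOpen_J S.contDiff_f₂ hr).hasDerivAt

theorem hasDerivAt_deriv_f₂ (hr : r ∈ S.J) : HasDerivAt (deriv S.f₂) (deriv (deriv S.f₂) r) r :=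
  (differentiableAt_deriv_of_contDiffOn S.isOpen_J S.contDiff_f₂ hr).hasDerivAt

theorem a_ne_zero (ht : t ∈ S.I) : S.a t ≠ 0 := (S.a_pos t ht).ne'
theorem b_ne_zero (hr : r ∈ S.J) : S.b r ≠ 0 := (S.b_pos r hr).ne'
theorem f₁_ne_zero (hr : r ∈ S.J) : S.f₁ r ≠ 0 := (S.f₁_pos r hr).ne'
theorem f₂_ne_zero (hr : r ∈ S.J) : S.f₂ r ≠ 0 := (S.f₂_pos r hr).ne'

end regularity

/-! ### Inverse metric and Christoffel symbols of the doubly warped metric -/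

variable (S)

/-- The components of the inverse metric. -/
def metricInv (x : Idx N → ℝ) : Matrix (Idx N) (Idx N) ℝ := fun i j =>
  match i, j with
  | Sum.inl _, Sum.inl _ => -(1 / S.b (rad x) ^ 2)
  | Sum.inr (Sum.inl _), Sum.inr (Sum.inl _) => 1 / (S.a (time x) ^ 2 * S.f₁ (rad x) ^ 2)
  | Sum.inr (Sum.inr c), Sum.inr (Sum.inr d) =>
      1 / (S.a (time x) ^ 2 * S.f₂ (rad x) ^ 2) * (S.sphereGram (ang x))⁻¹ c d
  | _, _ => 0

/-- The first derivatives `∂_k g_{ij}` of the metric. -/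
def metricDeriv (k i j : Idx N) (x : Idx N → ℝ) : ℝ :=
  match k, i, j with
  | Sum.inr (Sum.inl _), Sum.inl _, Sum.inl _ => -(2 * S.b (rad x) * deriv S.b (rad x))
  | Sum.inl _, Sum.inr (Sum.inl _), Sum.inr (Sum.inl _) =>
      2 * S.a (time x) * deriv S.a (time x) * S.f₁ (rad x) ^ 2
  | Sum.inr (Sum.inl _), Sum.inr (Sum.inl _), Sum.inr (Sum.inl _) =>
      S.a (time x) ^ 2 * (2 * S.f₁ (rad x) * deriv S.f₁ (rad x))
  | Sum.inl _, Sum.inr (Sum.inr c), Sum.inr (Sum.inr d) =>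
      2 * S.a (time x) * deriv S.a (time x) * S.f₂ (rad x) ^ 2 * S.sphereMetric (ang x) c d
  | Sum.inr (Sum.inl _), Sum.inr (Sum.inr c), Sum.inr (Sum.inr d) =>
      S.a (time x) ^ 2 * (2 * S.f₂ (rad x) * deriv S.f₂ (rad x)) * S.sphereMetric (ang x) c d
  | Sum.inr (Sum.inr e), Sum.inr (Sum.inr c), Sum.inr (Sum.inr d) =>
      S.a (time x) ^ 2 * S.f₂ (rad x) ^ 2 * pd e (fun y => S.sphereMetric y c d) (ang x)
  | _, _, _ => 0

/-- The time dependence of `Γ^k_{ij}`. -/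
def chrT (k i j : Idx N) : ℝ → ℝ :=
  match k, i, j with
  | Sum.inl _, Sum.inr (Sum.inl _), Sum.inr (Sum.inl _) => fun t => S.a t * deriv S.a t
  | Sum.inl _, Sum.inr (Sum.inr _), Sum.inr (Sum.inr _) => fun t => S.a t * deriv S.a t
  | Sum.inr (Sum.inl _), Sum.inl _, Sum.inl _ => fun t => (S.a t ^ 2)⁻¹
  | Sum.inr _, Sum.inl _, Sum.inr _ => fun t => deriv S.a t / S.a t
  | Sum.inr _, Sum.inr _, Sum.inl _ => fun t => deriv S.a t / S.a t
  | _, _, _ => fun _ => 1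

/-- The radial dependence of `Γ^k_{ij}`. -/
def chrR (k i j : Idx N) : ℝ → ℝ :=
  match k, i, j with
  | Sum.inl _, Sum.inl _, Sum.inr _ => fun r => deriv S.b r / S.b r
  | Sum.inl _, Sum.inr _, Sum.inl _ => fun r => deriv S.b r / S.b r
  | Sum.inl _, Sum.inr (Sum.inl _), Sum.inr (Sum.inl _) => fun r => S.f₁ r ^ 2 / S.b r ^ 2
  | Sum.inl _, Sum.inr (Sum.inr _), Sum.inr (Sum.inr _) => fun r => S.f₂ r ^ 2 / S.b r ^ 2
  | Sum.inr (Sum.inl _), Sum.inl _, Sum.inl _ => fun r => S.b r * deriv S.b r / S.f₁ r ^ 2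
  | Sum.inr (Sum.inl _), Sum.inr (Sum.inl _), Sum.inr (Sum.inl _) =>
      fun r => deriv S.f₁ r / S.f₁ r
  | Sum.inr (Sum.inl _), Sum.inr (Sum.inr _), Sum.inr (Sum.inr _) =>
      fun r => -(S.f₂ r * deriv S.f₂ r / S.f₁ r ^ 2)
  | Sum.inr (Sum.inr _), Sum.inr (Sum.inl _), Sum.inr (Sum.inr _) =>
      fun r => deriv S.f₂ r / S.f₂ r
  | Sum.inr (Sum.inr _), Sum.inr (Sum.inr _), Sum.inr (Sum.inl _) =>
      fun r => deriv S.f₂ r / S.f₂ r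
  | _, _, _ => fun _ => 1

/-- The angular dependence of `Γ^k_{ij}`. -/
def chrA (k i j : Idx N) : (Fin N → ℝ) → ℝ :=
  match k, i, j with
  | Sum.inl _, Sum.inl _, Sum.inr (Sum.inl _) => fun _ => 1
  | Sum.inl _, Sum.inr (Sum.inl _), Sum.inl _ => fun _ => 1
  | Sum.inl _, Sum.inr (Sum.inl _), Sum.inr (Sum.inl _) => fun _ => 1
  | Sum.inl _, Sum.inr (Sum.inr c), Sum.inr (Sum.inr d) => fun y => S.sphereMetric y c d
  | Sum.inr (Sum.inl _), Sum.inl _, Sum.inl _ => fun _ => 1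
  | Sum.inr (Sum.inl _), Sum.inl _, Sum.inr (Sum.inl _) => fun _ => 1
  | Sum.inr (Sum.inl _), Sum.inr (Sum.inl _), Sum.inl _ => fun _ => 1
  | Sum.inr (Sum.inl _), Sum.inr (Sum.inl _), Sum.inr (Sum.inl _) => fun _ => 1
  | Sum.inr (Sum.inl _), Sum.inr (Sum.inr c), Sum.inr (Sum.inr d) => fun y => S.sphereMetric y c d
  | Sum.inr (Sum.inr c), Sum.inl _, Sum.inr (Sum.inr d) => fun _ => if c = d then 1 else 0
  | Sum.inr (Sum.inr c), Sum.inr (Sum.inr d), Sum.inl _ => fun _ => if c = d then 1 else 0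
  | Sum.inr (Sum.inr c), Sum.inr (Sum.inl _), Sum.inr (Sum.inr d) =>
      fun _ => if c = d then 1 else 0
  | Sum.inr (Sum.inr c), Sum.inr (Sum.inr d), Sum.inr (Sum.inl _) =>
      fun _ => if c = d then 1 else 0
  | Sum.inr (Sum.inr c), Sum.inr (Sum.inr d), Sum.inr (Sum.inr e) => christoffel S.sphereGram c d e
  | _, _, _ => fun _ => 0

variable {S}

theorem inv_metric (hx : x ∈ S.domain) : (S.metric x)⁻¹ = S.metricInv x := by
  refine Matrix.inv_eq_right_inv ?_
  have h1 := b_ne_zero hx.2.1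
  have h2 := a_ne_zero hx.1
  have h3 := f₁_ne_zero hx.2.1
  have h4 := f₂_ne_zero hx.2.1
  ext i j
  rw [Matrix.mul_apply]
  rcases i with _ | _ | c <;> rcases j with _ | _ | d <;>
    simp [Fintype.sum_sum_type, metric, metricInv, Matrix.one_apply]
  · field_simp
  · field_simp
  · rw [← sum_sphereMetric_mul_inv hx.2.2]
    refine Finset.sum_congr rfl fun e _ => ?_
    field_simp

theorem differentiableAt_sphereMetric {y : Fin N → ℝ} (hy : y ∈ S.U) (c d : Fin N) :
    DifferentiableAt ℝ (fun y => S.sphereMetric y c d) y :=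
  (contDiffAt_sphereMetric hy c d).differentiableAt (by simp)

theorem pd_metric (hx : x ∈ S.domain) (k i j : Idx N) :
    pd k (fun y => S.metric y i j) x = S.metricDeriv k i j x := by
  have ha := (hasDerivAt_a hx.1).fun_pow 2
  have hb := ((hasDerivAt_b hx.2.1).fun_pow 2).fun_neg
  have hf₁ := (hasDerivAt_f₁ hx.2.1).fun_pow 2
  have hf₂ := (hasDerivAt_f₂ hx.2.1).fun_pow 2
  have htt : ∀ o o' : Unit, (fun y => S.metric y (Sum.inl o) (Sum.inl o')) =
      sep (fun _ => 1) (fun r => -S.b r ^ 2) (fun _ => 1) := fun _ _ => by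
    ext y; simp [metric, sep]
  have hrr : ∀ o o' : Unit, (fun y => S.metric y (Sum.inr (Sum.inl o)) (Sum.inr (Sum.inl o'))) =
      sep (fun t => S.a t ^ 2) (fun r => S.f₁ r ^ 2) (fun _ => 1) := fun _ _ => by
    ext y; simp [metric, sep]
  have hcd : ∀ c d, (fun y => S.metric y (Sum.inr (Sum.inr c)) (Sum.inr (Sum.inr d))) =
      sep (fun t => S.a t ^ 2) (fun r => S.f₂ r ^ 2) (fun y => S.sphereMetric y c d) :=
    fun _ _ => by
      ext y; simp [metric, sep, mul_assoc]
  have hc : ∀ {E : Type} [NormedAddCommGroup E] [NormedSpace ℝ E] (z : E),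
    DifferentiableAt ℝ (fun _ => (1 : ℝ)) z := fun z => differentiableAt_const _
  have hσ := fun c d => differentiableAt_sphereMetric hx.2.2 c d
  rcases i with _ | _ | c <;> rcases j with _ | _ | d
  case inl.inl =>
    rw [htt]
    rcases k with _ | _ | e
    · rw [pd_time_sep (hc _) hb.differentiableAt (hc _)]; simp [metricDeriv]
    · rw [pd_rad_sep (hc _) hb.differentiableAt (hc _), hb.deriv]; simp [metricDeriv]
    · rw [pd_ang_sep (hc _) hb.differentiableAt (hc _), pd_const]; simp [metricDeriv]
  case inr.inl.inr.inl =>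
    rw [hrr]
    rcases k with _ | _ | e
    · rw [pd_time_sep ha.differentiableAt hf₁.differentiableAt (hc _), ha.deriv]
      simp [metricDeriv]
    · rw [pd_rad_sep ha.differentiableAt hf₁.differentiableAt (hc _), hf₁.deriv]
      simp [metricDeriv]
    · rw [pd_ang_sep ha.differentiableAt hf₁.differentiableAt (hc _), pd_const]
      simp [metricDeriv]
  case inr.inr.inr.inr =>
    rw [hcd]
    rcases k with _ | _ | e
    · rw [pd_time_sep ha.differentiableAt hf₂.differentiableAt (hσ _ _), ha.deriv]
      simp [metricDeriv]
    · rw [pd_rad_sep ha.differentiableAt hf₂.differentiableAt (hσ _ _), hf₂.deriv]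
      simp [metricDeriv]
    · rw [pd_ang_sep ha.differentiableAt hf₂.differentiableAt (hσ _ _)]
      simp [metricDeriv]
  -- The remaining components are off the block diagonal and vanish identically.
  all_goals rcases k with _ | _ | e <;> simpa [metric, metricDeriv] using pd_const _ _ _

/-- Vanishing symbols are encoded by `chrA` alone; the values of `chrT` and `chrR` are irrelevant
there, which makes their default `1` harmless. -/
theorem christoffel_metric (hx : x ∈ S.domain) (k i j : Idx N) :
    christoffel S.metric k i j x = sep (S.chrT k i j) (S.chrR k i j) (S.chrA k i j) x := by
  have h1 := b_ne_zero hx.2.1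
  have h2 := a_ne_zero hx.1
  have h3 := f₁_ne_zero hx.2.1
  have h4 := f₂_ne_zero hx.2.1
  have hinv : ∀ (c d : Fin N) (A B : ℝ), ∑ l, A * (S.sphereGram (ang x))⁻¹ c l *
      (B * S.sphereMetric (ang x) d l) = A * B * if c = d then 1 else 0 := by
    intro c d A B
    rw [← sum_inv_mul_sphereMetric hx.2.2, Finset.mul_sum]
    refine Finset.sum_congr rfl fun l _ => ?_
    rw [sphereMetric_symm _ l d]
    ring
  unfold christoffel
  rw [inv_metric hx]
  simp only [pd_metric hx, Fintype.sum_sum_type, Finset.univ_unique, Finset.sum_singleton]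
  rcases k with _ | _ | c <;> rcases i with _ | _ | d <;> rcases j with _ | _ | e
  -- In the purely angular block the warping factors cancel, leaving the symbols of the sphere.
  case inr.inr.inr.inr.inr.inr =>
    simp only [metricInv, metricDeriv, sep, chrT, chrR, chrA, zero_mul, zero_add, one_mul,
      christoffel, sphereGram_apply]
    congr 1
    refine Finset.sum_congr rfl fun l _ => ?_
    field_simp
  all_goals
    simp only [metricInv, metricDeriv, sep, chrT, chrR, chrA, zero_mul, Finset.sum_const_zero,
      add_zero, zero_add, mul_zero, sub_zero, hinv, mul_one, one_mul]
  all_goals try field_simp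
  all_goals try ring

end SphericalDW

/-! ### Curvature of the doubly warped metric -/

namespace SphericalDW

variable {N : ℕ} {S : SphericalDW N} {x : Idx N → ℝ}

section derivatives

variable {t r : ℝ}

theorem hasDerivAt_a_mul_deriv_a (ht : t ∈ S.I) :
    HasDerivAt (fun t => S.a t * deriv S.a t)
      (deriv S.a t * deriv S.a t + S.a t * deriv (deriv S.a) t) t :=
  (hasDerivAt_a ht).fun_mul (hasDerivAt_deriv_a ht)

theorem hasDerivAt_inv_a_sq (ht : t ∈ S.I) :
    HasDerivAt (fun t => (S.a t ^ 2)⁻¹) (-(2 * S.a t * deriv S.a t) / (S.a t ^ 2) ^ 2) t := by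
  simpa using ((hasDerivAt_a ht).fun_pow 2).fun_inv (pow_ne_zero 2 (a_ne_zero ht))

theorem hasDerivAt_deriv_a_div_a (ht : t ∈ S.I) :
    HasDerivAt (fun t => deriv S.a t / S.a t)
      ((deriv (deriv S.a) t * S.a t - deriv S.a t * deriv S.a t) / S.a t ^ 2) t :=
  (hasDerivAt_deriv_a ht).fun_div (hasDerivAt_a ht) (a_ne_zero ht)

theorem hasDerivAt_deriv_b_div_b (hr : r ∈ S.J) :
    HasDerivAt (fun r => deriv S.b r / S.b r)
      ((deriv (deriv S.b) r * S.b r - deriv S.b r * deriv S.b r) / S.b r ^ 2) r :=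
  (hasDerivAt_deriv_b hr).fun_div (hasDerivAt_b hr) (b_ne_zero hr)

theorem hasDerivAt_deriv_f₁_div_f₁ (hr : r ∈ S.J) :
    HasDerivAt (fun r => deriv S.f₁ r / S.f₁ r)
      ((deriv (deriv S.f₁) r * S.f₁ r - deriv S.f₁ r * deriv S.f₁ r) / S.f₁ r ^ 2) r :=
  (hasDerivAt_deriv_f₁ hr).fun_div (hasDerivAt_f₁ hr) (f₁_ne_zero hr)

theorem hasDerivAt_deriv_f₂_div_f₂ (hr : r ∈ S.J) :
    HasDerivAt (fun r => deriv S.f₂ r / S.f₂ r)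
      ((deriv (deriv S.f₂) r * S.f₂ r - deriv S.f₂ r * deriv S.f₂ r) / S.f₂ r ^ 2) r :=
  (hasDerivAt_deriv_f₂ hr).fun_div (hasDerivAt_f₂ hr) (f₂_ne_zero hr)

theorem hasDerivAt_f₁_sq_div_b_sq (hr : r ∈ S.J) :
    HasDerivAt (fun r => S.f₁ r ^ 2 / S.b r ^ 2)
      ((2 * S.f₁ r * deriv S.f₁ r * S.b r ^ 2 - S.f₁ r ^ 2 * (2 * S.b r * deriv S.b r))
        / (S.b r ^ 2) ^ 2) r := by
  simpa using ((hasDerivAt_f₁ hr).fun_pow 2).fun_div ((hasDerivAt_b hr).fun_pow 2)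
    (pow_ne_zero 2 (b_ne_zero hr))

theorem hasDerivAt_f₂_sq_div_b_sq (hr : r ∈ S.J) :
    HasDerivAt (fun r => S.f₂ r ^ 2 / S.b r ^ 2)
      ((2 * S.f₂ r * deriv S.f₂ r * S.b r ^ 2 - S.f₂ r ^ 2 * (2 * S.b r * deriv S.b r))
        / (S.b r ^ 2) ^ 2) r := by
  simpa using ((hasDerivAt_f₂ hr).fun_pow 2).fun_div ((hasDerivAt_b hr).fun_pow 2)
    (pow_ne_zero 2 (b_ne_zero hr))

theorem hasDerivAt_b_mul_deriv_b_div (hr : r ∈ S.J) :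
    HasDerivAt (fun r => S.b r * deriv S.b r / S.f₁ r ^ 2)
      (((deriv S.b r * deriv S.b r + S.b r * deriv (deriv S.b) r) * S.f₁ r ^ 2
        - S.b r * deriv S.b r * (2 * S.f₁ r * deriv S.f₁ r)) / (S.f₁ r ^ 2) ^ 2) r := by
  simpa using ((hasDerivAt_b hr).fun_mul (hasDerivAt_deriv_b hr)).fun_div
    ((hasDerivAt_f₁ hr).fun_pow 2) (pow_ne_zero 2 (f₁_ne_zero hr))

theorem hasDerivAt_f₂_mul_deriv_f₂_div (hr : r ∈ S.J) :
    HasDerivAt (fun r => -(S.f₂ r * deriv S.f₂ r / S.f₁ r ^ 2))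
      (-(((deriv S.f₂ r * deriv S.f₂ r + S.f₂ r * deriv (deriv S.f₂) r) * S.f₁ r ^ 2
        - S.f₂ r * deriv S.f₂ r * (2 * S.f₁ r * deriv S.f₁ r)) / (S.f₁ r ^ 2) ^ 2)) r := by
  simpa using (((hasDerivAt_f₂ hr).fun_mul (hasDerivAt_deriv_f₂ hr)).fun_div
    ((hasDerivAt_f₁ hr).fun_pow 2) (pow_ne_zero 2 (f₁_ne_zero hr))).fun_neg

theorem differentiableAt_chrT (ht : t ∈ S.I) (k i j : Idx N) :
    DifferentiableAt ℝ (S.chrT k i j) t := by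
  unfold chrT
  split
  · exact (hasDerivAt_a_mul_deriv_a ht).differentiableAt
  · exact (hasDerivAt_a_mul_deriv_a ht).differentiableAt
  · exact (hasDerivAt_inv_a_sq ht).differentiableAt
  · exact (hasDerivAt_deriv_a_div_a ht).differentiableAt
  · exact (hasDerivAt_deriv_a_div_a ht).differentiableAt
  · exact differentiableAt_const _

theorem differentiableAt_chrR (hr : r ∈ S.J) (k i j : Idx N) :
    DifferentiableAt ℝ (S.chrR k i j) r := by
  unfold chrR
  split
  · exact (hasDerivAt_deriv_b_div_b hr).differentiableAt
  · exact (hasDerivAt_deriv_b_div_b hr).differentiableAt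
  · exact (hasDerivAt_f₁_sq_div_b_sq hr).differentiableAt
  · exact (hasDerivAt_f₂_sq_div_b_sq hr).differentiableAt
  · exact (hasDerivAt_b_mul_deriv_b_div hr).differentiableAt
  · exact (hasDerivAt_deriv_f₁_div_f₁ hr).differentiableAt
  · exact (hasDerivAt_f₂_mul_deriv_f₂_div hr).differentiableAt
  · exact (hasDerivAt_deriv_f₂_div_f₂ hr).differentiableAt
  · exact (hasDerivAt_deriv_f₂_div_f₂ hr).differentiableAt
  · exact differentiableAt_const _

theorem differentiableAt_chrA {y : Fin N → ℝ} (hy : y ∈ S.U) (k i j : Idx N) :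
    DifferentiableAt ℝ (S.chrA k i j) y := by
  unfold chrA
  split
  -- The purely angular branch, the only one that is neither constant nor a component of the round
  -- metric.
  case h_14 => exact differentiableAt_christoffel_sphereMetric hy _ _ _
  all_goals first
    | exact differentiableAt_const _
    | exact differentiableAt_sphereMetric hy _ _

end derivatives

/-- The factored form holds on the whole open domain, so it can be differentiated. -/
theorem pd_time_christoffel (hx : x ∈ S.domain) (o : Unit) (k i j : Idx N) :
    pd (Sum.inl o) (christoffel S.metric k i j) x =
      deriv (S.chrT k i j) (time x) * S.chrR k i j (rad x) * S.chrA k i j (ang x) := by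
  rw [pd_congr_domain hx fun y hy => christoffel_metric hy k i j]
  exact pd_time_sep (differentiableAt_chrT hx.1 k i j) (differentiableAt_chrR hx.2.1 k i j)
    (differentiableAt_chrA hx.2.2 k i j) o

theorem pd_rad_christoffel (hx : x ∈ S.domain) (o : Unit) (k i j : Idx N) :
    pd (Sum.inr (Sum.inl o)) (christoffel S.metric k i j) x =
      S.chrT k i j (time x) * deriv (S.chrR k i j) (rad x) * S.chrA k i j (ang x) := by
  rw [pd_congr_domain hx fun y hy => christoffel_metric hy k i j]
  exact pd_rad_sep (differentiableAt_chrT hx.1 k i j) (differentiableAt_chrR hx.2.1 k i j)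
    (differentiableAt_chrA hx.2.2 k i j) o

theorem pd_ang_christoffel (hx : x ∈ S.domain) (c : Fin N) (k i j : Idx N) :
    pd (Sum.inr (Sum.inr c)) (christoffel S.metric k i j) x =
      S.chrT k i j (time x) * S.chrR k i j (rad x) * pd c (S.chrA k i j) (ang x) := by
  rw [pd_congr_domain hx fun y hy => christoffel_metric hy k i j]
  exact pd_ang_sep (differentiableAt_chrT hx.1 k i j) (differentiableAt_chrR hx.2.1 k i j)
    (differentiableAt_chrA hx.2.2 k i j) c

variable (S) in
/-- The components of the Ricci tensor of a doubly warped metric. -/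
def ricciTable (x : Idx N → ℝ) (i j : Idx N) : ℝ :=
  let a := S.a (time x)
  let a' := deriv S.a (time x)
  let a'' := deriv (deriv S.a) (time x)
  let b := S.b (rad x)
  let b' := deriv S.b (rad x)
  let b'' := deriv (deriv S.b) (rad x)
  let f₁ := S.f₁ (rad x)
  let f₁' := deriv S.f₁ (rad x)
  let f₂ := S.f₂ (rad x)
  let f₂' := deriv S.f₂ (rad x)
  let f₂'' := deriv (deriv S.f₂) (rad x)
  match i, j with
  | Sum.inl _, Sum.inl _ =>
      b * (b'' - b' * f₁' / f₁ + N * b' * f₂' / f₂) / (a ^ 2 * f₁ ^ 2) - (N + 1) * a'' / a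
  | Sum.inl _, Sum.inr (Sum.inl _) => N * a' * b' / (a * b)
  | Sum.inr (Sum.inl _), Sum.inl _ => N * a' * b' / (a * b)
  | Sum.inr (Sum.inl _), Sum.inr (Sum.inl _) =>
      (a * a'' + N * a' ^ 2) * f₁ ^ 2 / b ^ 2 - b'' / b + b' * f₁' / (b * f₁)
        - N * f₂'' / f₂ + N * f₁' * f₂' / (f₁ * f₂)
  | Sum.inr (Sum.inr c), Sum.inr (Sum.inr d) =>
      ((a * a'' + N * a' ^ 2) * f₂ ^ 2 / b ^ 2
        - f₂ * (f₂'' - f₁' * f₂' / f₁ + b' * f₂' / b) / f₁ ^ 2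
        - (N - 1) * f₂' ^ 2 / f₁ ^ 2 + (N - 1)) * S.sphereMetric (ang x) c d
  | _, _ => 0

theorem christoffel_sphereGram_symm (k i j : Fin N) (y : Fin N → ℝ) :
    christoffel S.sphereGram k i j y = christoffel S.sphereGram k j i y :=
  christoffel_symm (fun y c d => sphereMetric_symm y c d) k i j y

theorem ricci_metric (hx : x ∈ S.domain) (i j : Idx N) :
    ricci S.metric x i j = S.ricciTable x i j := by
  have h1 := b_ne_zero hx.2.1
  have h2 := a_ne_zero hx.1
  have h3 := f₁_ne_zero hx.2.1
  have h4 := f₂_ne_zero hx.2.1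
  have hR := ricci_sphereMetric hx.2.2
  have hsymm := fun k => christoffel_sphereGram_symm (S := S) k
  unfold ricci at hR ⊢
  simp only [christoffel_metric hx, Fintype.sum_sum_type, Finset.univ_unique, Finset.sum_singleton]
  rcases i with _ | _ | c <;> rcases j with _ | _ | d <;>
    simp only [pd_time_christoffel hx, pd_rad_christoffel hx, pd_ang_christoffel hx, sep,
      chrT, chrR, chrA, pd_const, deriv_const, (hasDerivAt_a_mul_deriv_a hx.1).deriv,
      (hasDerivAt_deriv_a_div_a hx.1).deriv,
      (hasDerivAt_deriv_b_div_b hx.2.1).deriv, (hasDerivAt_deriv_f₁_div_f₁ hx.2.1).deriv,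
      (hasDerivAt_deriv_f₂_div_f₂ hx.2.1).deriv,
      (hasDerivAt_b_mul_deriv_b_div hx.2.1).deriv,
      (hasDerivAt_f₂_mul_deriv_f₂_div hx.2.1).deriv, mul_zero, zero_mul, add_zero, zero_add,
      sub_zero, zero_sub, sub_self, Finset.sum_const_zero, mul_one, one_mul, ricciTable,
      mul_ite, ite_mul, Finset.sum_sub_distrib, Finset.sum_add_distrib, Finset.sum_ite_eq,
      Finset.sum_ite_eq', Finset.mem_univ, if_true, Finset.sum_const, Finset.card_univ,
      Fintype.card_fin, nsmul_eq_mul, Finset.sum_neg_distrib]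
  case inl.inl => field_simp; ring
  case inl.inr.inl => field_simp; ring
  case inr.inl.inl => field_simp; ring
  case inr.inl.inr.inl => field_simp; ring
  -- Traces of the sphere's symbols remain, with opposite signs; they cancel after exchanging lower
  -- indices.
  case inl.inr.inr => simp [hsymm _ d]
  case inr.inl.inr.inr => simp [hsymm _ d]
  case inr.inr.inl => simp [mul_comm]
  case inr.inr.inr.inl => simp [mul_comm]
  case inr.inr.inr.inr =>
    have hcd := hR c d
    simp only [Finset.sum_sub_distrib] at hcd
    field_simp
    -- The sphere's own Ricci terms are traded for `(N - 1)` times its metric; the coefficient is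
    -- the factor they acquire when denominators are cleared.
    linear_combination (S.b (rad x) ^ 2 * S.f₁ (rad x) ^ 3) * hcd

/-- Since `u` has only a time component, these are the only Riemann components entering the electric
tensor. -/
theorem riemann_time_time (hx : x ∈ S.domain) (k l : Idx N) :
    riemann S.metric (Sum.inl ()) k l (Sum.inl ()) x =
      match k, l with
      | Sum.inr (Sum.inl _), Sum.inr (Sum.inl _) =>
        -(S.a (time x) * deriv (deriv S.a) (time x) * S.f₁ (rad x) ^ 2 / S.b (rad x) ^ 2)
          + deriv (deriv S.b) (rad x) / S.b (rad x)
          - deriv S.b (rad x) * deriv S.f₁ (rad x) / (S.b (rad x) * S.f₁ (rad x))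
      | Sum.inr (Sum.inr c), Sum.inr (Sum.inr d) =>
        (-(S.a (time x) * deriv (deriv S.a) (time x) * S.f₂ (rad x) ^ 2 / S.b (rad x) ^ 2)
          + S.f₂ (rad x) * deriv S.f₂ (rad x) * deriv S.b (rad x)
            / (S.b (rad x) * S.f₁ (rad x) ^ 2)) * S.sphereMetric (ang x) c d
      | _, _ => 0 := by
  have h1 := b_ne_zero hx.2.1
  have h2 := a_ne_zero hx.1
  have h3 := f₁_ne_zero hx.2.1
  have h4 := f₂_ne_zero hx.2.1
  unfold riemann
  simp only [christoffel_metric hx, Fintype.sum_sum_type, Finset.univ_unique, Finset.sum_singleton]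
  rcases k with _ | _ | c <;> rcases l with _ | _ | d <;>
    simp only [pd_time_christoffel hx, pd_rad_christoffel hx, pd_ang_christoffel hx, sep,
      chrT, chrR, chrA, pd_const, deriv_const, (hasDerivAt_a_mul_deriv_a hx.1).deriv,
      (hasDerivAt_deriv_b_div_b hx.2.1).deriv, mul_zero, zero_mul, add_zero, zero_add,
      sub_zero, zero_sub, sub_self, Finset.sum_const_zero, mul_one, one_mul, neg_zero,
      mul_ite, ite_mul, Finset.sum_ite_eq', Finset.mem_univ, if_true]
  all_goals try field_simp
  all_goals try ring

/-! ### Kinematics of the comoving velocity -/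

theorem raise_time (hx : x ∈ S.domain) (w : (Idx N → ℝ) → Idx N → ℝ) (o : Unit) :
    raise S.metric w x (Sum.inl o) = -(1 / S.b (rad x) ^ 2) * w x (Sum.inl ()) := by
  simp [raise, inv_metric hx, metricInv, Fintype.sum_sum_type]

theorem raise_rad (hx : x ∈ S.domain) (w : (Idx N → ℝ) → Idx N → ℝ) (o : Unit) :
    raise S.metric w x (Sum.inr (Sum.inl o)) =
      1 / (S.a (time x) ^ 2 * S.f₁ (rad x) ^ 2) * w x (Sum.inr (Sum.inl ())) := by
  simp [raise, inv_metric hx, metricInv, Fintype.sum_sum_type]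

theorem raise_ang (hx : x ∈ S.domain) {w : (Idx N → ℝ) → Idx N → ℝ}
    (hw : ∀ d, w x (Sum.inr (Sum.inr d)) = 0) (c : Fin N) :
    raise S.metric w x (Sum.inr (Sum.inr c)) = 0 := by
  simp [raise, inv_metric hx, metricInv, Fintype.sum_sum_type, hw]

theorem raise_u (hx : x ∈ S.domain) (i : Idx N) :
    raise S.metric S.u x i = match i with
      | Sum.inl _ => 1 / S.b (rad x)
      | _ => 0 := by
  have h1 := b_ne_zero hx.2.1
  rcases i with _ | _ | c
  · rw [raise_time hx]
    simp only [u]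
    field_simp
  · rw [raise_rad hx]
    simp [u]
  · exact raise_ang hx (fun _ => rfl) c

theorem raise_radial (hx : x ∈ S.domain) (i : Idx N) :
    raise S.metric S.radial x i = match i with
      | Sum.inr (Sum.inl _) => 1 / (S.a (time x) * S.f₁ (rad x))
      | _ => 0 := by
  have h2 := a_ne_zero hx.1
  have h3 := f₁_ne_zero hx.2.1
  rcases i with _ | _ | c
  · rw [raise_time hx]
    simp [radial]
  · rw [raise_rad hx]
    simp only [radial]
    field_simp
  · exact raise_ang hx (fun _ => rfl) c

theorem sum_inv_mul_sphereMetric_trace {y : Fin N → ℝ} (hy : y ∈ S.U) (A B : ℝ) :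
    ∑ c, ∑ d, A * (S.sphereGram y)⁻¹ c d * (B * S.sphereMetric y c d) = N * (A * B) := by
  have h : ∀ c, ∑ d, A * (S.sphereGram y)⁻¹ c d * (B * S.sphereMetric y c d) = A * B := by
    intro c
    have := sum_inv_mul_sphereMetric hy c c
    rw [if_pos rfl] at this
    rw [← mul_one (A * B), ← this, Finset.mul_sum]
    refine Finset.sum_congr rfl fun d _ => ?_
    rw [sphereMetric_symm _ d c]
    ring
  simp [h]

/-- The full contraction with the inverse metric of a tensor that is proportional to the round
metric in the angular block. -/
theorem sum_inv_metric_mul (hx : x ∈ S.domain) {F : Idx N → Idx N → ℝ} {κ : ℝ}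
    (hF : ∀ c d, F (Sum.inr (Sum.inr c)) (Sum.inr (Sum.inr d)) =
      κ * S.sphereMetric (ang x) c d) :
    ∑ i, ∑ j, (S.metric x)⁻¹ i j * F i j =
      -(1 / S.b (rad x) ^ 2) * F (Sum.inl ()) (Sum.inl ())
      + 1 / (S.a (time x) ^ 2 * S.f₁ (rad x) ^ 2) *
        F (Sum.inr (Sum.inl ())) (Sum.inr (Sum.inl ()))
      + N * (1 / (S.a (time x) ^ 2 * S.f₂ (rad x) ^ 2) * κ) := by
  rw [inv_metric hx]
  simp only [Fintype.sum_sum_type, Finset.univ_unique, Finset.sum_singleton, metricInv, hF,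
    zero_mul, Finset.sum_const_zero, add_zero, zero_add, sum_inv_mul_sphereMetric_trace hx.2.2]
  exact (add_assoc _ _ _).symm

theorem pd_u (hx : x ∈ S.domain) (i j : Idx N) :
    pd i (fun y => S.u y j) x = match i, j with
      | Sum.inr (Sum.inl _), Sum.inl _ => -deriv S.b (rad x)
      | _, _ => 0 := by
  rcases j with _ | _ | d
  · have e : (fun y => S.u y (Sum.inl ())) = sep (fun _ => 1) (fun r => -S.b r) (fun _ => 1) := by
      ext y; simp [u, sep]
    have hb := (hasDerivAt_b hx.2.1).fun_neg
    have h1 : DifferentiableAt ℝ (fun _ : ℝ => (1 : ℝ)) (time x) := differentiableAt_const _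
    have h2 : DifferentiableAt ℝ (fun _ : Fin N → ℝ => (1 : ℝ)) (ang x) := differentiableAt_const _
    rw [e]
    rcases i with _ | _ | c
    · rw [pd_time_sep h1 hb.differentiableAt h2]; simp
    · rw [pd_rad_sep h1 hb.differentiableAt h2, hb.deriv]; simp
    · rw [pd_ang_sep h1 hb.differentiableAt h2, pd_const]; simp
  all_goals rcases i with _ | _ | c <;> exact pd_const _ _ _

theorem covDeriv_u (hx : x ∈ S.domain) (i j : Idx N) :
    covDeriv S.metric S.u x i j = match i, j with
      | Sum.inl _, Sum.inr (Sum.inl _) => deriv S.b (rad x)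
      | Sum.inr (Sum.inl _), Sum.inr (Sum.inl _) =>
          S.a (time x) * deriv S.a (time x) * S.f₁ (rad x) ^ 2 / S.b (rad x)
      | Sum.inr (Sum.inr c), Sum.inr (Sum.inr d) =>
          S.a (time x) * deriv S.a (time x) * S.f₂ (rad x) ^ 2 / S.b (rad x)
            * S.sphereMetric (ang x) c d
      | _, _ => 0 := by
  have h1 := b_ne_zero hx.2.1
  unfold covDeriv
  rw [pd_u hx]
  simp only [christoffel_metric hx, Fintype.sum_sum_type, Finset.univ_unique, Finset.sum_singleton]
  rcases i with _ | _ | c <;> rcases j with _ | _ | d <;>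
    simp only [sep, chrT, chrR, chrA, u, mul_zero, zero_mul, Finset.sum_const_zero, add_zero,
      sub_self]
  all_goals field_simp
  all_goals try ring

variable (S) in
/-- The amplitude of the acceleration: `u̇_j = A N_j`. -/
def accelAmp (x : Idx N → ℝ) : ℝ :=
  deriv S.b (rad x) / (S.b (rad x) * S.a (time x) * S.f₁ (rad x))

theorem accel_rad (hx : x ∈ S.domain) (o : Unit) :
    S.accel x (Sum.inr (Sum.inl o)) = deriv S.b (rad x) / S.b (rad x) := by
  simp only [accel, raise_u hx, covDeriv_u hx, Fintype.sum_sum_type, Finset.univ_unique,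
    Finset.sum_singleton, zero_mul, Finset.sum_const_zero, add_zero]
  ring

/-- Only `∇_0 u_r` survives contraction with `u`, so the acceleration is radial and its terms become
frame terms. -/
theorem accel_eq (hx : x ∈ S.domain) (j : Idx N) :
    S.accel x j = S.accelAmp x * S.radial x j := by
  have h1 := b_ne_zero hx.2.1
  have h2 := a_ne_zero hx.1
  have h3 := f₁_ne_zero hx.2.1
  rcases j with _ | _ | d
  · simp [accel, raise_u hx, covDeriv_u hx, radial]
  · rw [accel_rad hx]
    simp only [radial, accelAmp]
    field_simp
  · simp [accel, raise_u hx, covDeriv_u hx, radial, Fintype.sum_sum_type]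

theorem pd_accel (hx : x ∈ S.domain) (i j : Idx N) :
    pd i (fun y => S.accel y j) x = match i, j with
      | Sum.inr (Sum.inl _), Sum.inr (Sum.inl _) =>
        (deriv (deriv S.b) (rad x) * S.b (rad x) - deriv S.b (rad x) * deriv S.b (rad x))
          / S.b (rad x) ^ 2
      | _, _ => 0 := by
  rcases j with _ | _ | d
  · rw [pd_congr_domain (g := fun _ => 0) hx fun y hy => by simp [accel_eq hy, radial], pd_const]
    rcases i with _ | _ | c <;> rfl
  · rw [pd_congr_domain (g := sep (fun _ => 1) (fun r => deriv S.b r / S.b r) (fun _ => 1)) hx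
      fun y hy => by simp [accel_rad hy, sep]]
    have hb := hasDerivAt_deriv_b_div_b hx.2.1
    have h1 : DifferentiableAt ℝ (fun _ : ℝ => (1 : ℝ)) (time x) := differentiableAt_const _
    have h2 : DifferentiableAt ℝ (fun _ : Fin N → ℝ => (1 : ℝ)) (ang x) := differentiableAt_const _
    rcases i with _ | _ | c
    · rw [pd_time_sep h1 hb.differentiableAt h2]; simp
    · rw [pd_rad_sep h1 hb.differentiableAt h2, hb.deriv]; simp
    · rw [pd_ang_sep h1 hb.differentiableAt h2, pd_const]; simp
  · rw [pd_congr_domain (g := fun _ => 0) hx fun y hy => by simp [accel_eq hy, radial], pd_const]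
    rcases i with _ | _ | c <;> rfl

theorem dim_sub_one : S.dim - 1 = N + 1 := by unfold dim; ring

theorem dim_sub_two : S.dim - 2 = N := by unfold dim; ring

theorem dim_sub_three : S.dim - 3 = N - 1 := by unfold dim; ring

theorem natCast_add_one_ne_zero (N : ℕ) : (N : ℝ) + 1 ≠ 0 := by positivity

/-- Both spatial blocks of `∇u` are the same multiple `a' / (a b)` of the metric: the flow is
shear-free. -/
theorem phi_eq (hx : x ∈ S.domain) :
    S.phi x = deriv S.a (time x) / (S.a (time x) * S.b (rad x)) := by
  have h1 := b_ne_zero hx.2.1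
  have h2 := a_ne_zero hx.1
  have h3 := f₁_ne_zero hx.2.1
  have h4 := f₂_ne_zero hx.2.1
  have h5 := natCast_add_one_ne_zero N
  have hcov : ∀ c d, covDeriv S.metric S.u x (Sum.inr (Sum.inr c)) (Sum.inr (Sum.inr d)) =
      S.a (time x) * deriv S.a (time x) * S.f₂ (rad x) ^ 2 / S.b (rad x)
            * S.sphereMetric (ang x) c d := fun c d => covDeriv_u hx _ _
  rw [phi, dim_sub_one, divergence, sum_inv_metric_mul hx hcov]
  simp only [covDeriv_u hx]
  field_simp
  ring

theorem xi_eq (hx : x ∈ S.domain) :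
    S.xi x = (N + 1) * deriv (deriv S.a) (time x) / (S.a (time x) * S.b (rad x) ^ 2) := by
  have h1 := b_ne_zero hx.2.1
  have h2 := a_ne_zero hx.1
  have hpd : pd (Sum.inl ()) S.phi x =
      (deriv (deriv S.a) (time x) * S.a (time x) - deriv S.a (time x) * deriv S.a (time x))
        / S.a (time x) ^ 2 * (S.b (rad x))⁻¹ := by
    rw [pd_congr_domain (g := sep (fun t => deriv S.a t / S.a t) (fun r => (S.b r)⁻¹)
      (fun _ => 1)) hx fun y hy => by simp [phi_eq hy, sep]; ring]
    rw [pd_time_sep (hasDerivAt_deriv_a_div_a hx.1).differentiableAt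
      ((hasDerivAt_b hx.2.1).differentiableAt.fun_inv h1) (differentiableAt_const _),
      (hasDerivAt_deriv_a_div_a hx.1).deriv, mul_one]
  simp only [xi, along, raise_u hx, Fintype.sum_sum_type, Finset.univ_unique,
    Finset.sum_singleton, zero_mul, Finset.sum_const_zero, add_zero, dim_sub_one, phi_eq hx]
  rw [show (default : Unit) = () from rfl, hpd]
  field_simp
  ring

theorem eta_eq (hx : x ∈ S.domain) : S.eta x = S.accelAmp x ^ 2 := by
  have h1 := b_ne_zero hx.2.1
  have h2 := a_ne_zero hx.1
  have h3 := f₁_ne_zero hx.2.1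
  simp only [eta, accel_eq hx, radial, Fintype.sum_sum_type, Finset.univ_unique,
    Finset.sum_singleton, mul_zero, zero_mul, Finset.sum_const_zero, add_zero, zero_add,
    raise_rad hx]
  field_simp

theorem along_accel_eta (hx : x ∈ S.domain) :
    along S.metric S.accel S.eta x =
      2 * deriv S.b (rad x) ^ 2 / (S.b (rad x) ^ 2 * S.a (time x) ^ 4 * S.f₁ (rad x) ^ 4) *
        (deriv (deriv S.b) (rad x) / S.b (rad x) - deriv S.b (rad x) ^ 2 / S.b (rad x) ^ 2
          - deriv S.b (rad x) * deriv S.f₁ (rad x) / (S.b (rad x) * S.f₁ (rad x))) := by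
  have h1 := b_ne_zero hx.2.1
  have h2 := a_ne_zero hx.1
  have h3 := f₁_ne_zero hx.2.1
  have hq := ((hasDerivAt_deriv_b_div_b hx.2.1).fun_div (hasDerivAt_f₁ hx.2.1) h3).fun_pow 2
  have hpd := pd_congr_domain (f := S.eta) (g := sep (fun t => (S.a t ^ 2)⁻¹)
    (fun r => (deriv S.b r / S.b r / S.f₁ r) ^ 2) (fun _ => 1)) hx
    (fun y hy => by rw [eta_eq hy]; simp [accelAmp, sep]; ring) (Sum.inr (Sum.inl ()))
  rw [pd_rad_sep (hasDerivAt_inv_a_sq hx.1).differentiableAt hq.differentiableAt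
    (differentiableAt_const _), hq.deriv, mul_one,
    show 2 - 1 = 1 from rfl, pow_one, Nat.cast_ofNat] at hpd
  have hang : ∀ c, raise S.metric S.accel x (Sum.inr (Sum.inr c)) = 0 :=
    raise_ang hx fun d => by simp [accel_eq hx, radial]
  have htime : raise S.metric S.accel x (Sum.inl ()) = 0 := by
    rw [raise_time hx, accel_eq hx]; simp [radial]
  simp only [along, Fintype.sum_sum_type, Finset.univ_unique, Finset.sum_singleton, hang,
    zero_mul, Finset.sum_const_zero, add_zero]
  rw [show (default : Unit) = () from rfl, htime, hpd, raise_rad hx, accel_rad hx]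
  field_simp
  ring

theorem divAccel_eq (hx : x ∈ S.domain) :
    S.divAccel x = 1 / (S.a (time x) ^ 2 * S.f₁ (rad x) ^ 2) *
      (deriv (deriv S.b) (rad x) / S.b (rad x)
        - deriv S.b (rad x) * deriv S.f₁ (rad x) / (S.b (rad x) * S.f₁ (rad x))
        + N * deriv S.b (rad x) * deriv S.f₂ (rad x) / (S.b (rad x) * S.f₂ (rad x))) := by
  have h1 := b_ne_zero hx.2.1
  have h2 := a_ne_zero hx.1
  have h3 := f₁_ne_zero hx.2.1
  have h4 := f₂_ne_zero hx.2.1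
  have hcov : ∀ i j, covDeriv S.metric S.accel x i j =
      (match i, j with
      | Sum.inr (Sum.inl _), Sum.inr (Sum.inl _) =>
        (deriv (deriv S.b) (rad x) * S.b (rad x) - deriv S.b (rad x) * deriv S.b (rad x))
          / S.b (rad x) ^ 2
      | _, _ => 0) - sep (S.chrT (Sum.inr (Sum.inl ())) i j) (S.chrR (Sum.inr (Sum.inl ())) i j)
        (S.chrA (Sum.inr (Sum.inl ())) i j) x * (deriv S.b (rad x) / S.b (rad x)) := by
    intro i j
    unfold covDeriv
    rw [pd_accel hx]
    simp only [Fintype.sum_sum_type, Finset.univ_unique, Finset.sum_singleton, accel_rad hx,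
      christoffel_metric hx]
    simp only [accel_eq hx, radial, mul_zero, Finset.sum_const_zero, add_zero, zero_add]
  have hκ : ∀ c d, covDeriv S.metric S.accel x (Sum.inr (Sum.inr c)) (Sum.inr (Sum.inr d)) =
      S.f₂ (rad x) * deriv S.f₂ (rad x) * deriv S.b (rad x) / (S.f₁ (rad x) ^ 2 * S.b (rad x))
        * S.sphereMetric (ang x) c d := by
    intro c d
    rw [hcov]
    simp only [sep, chrT, chrR, chrA]
    field_simp
    ring
  rw [divAccel, divergence, sum_inv_metric_mul hx hκ, hcov, hcov]
  simp only [sep, chrT, chrR, chrA]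
  field_simp
  ring

/-- The formula for `(log f₂)'` holds near `r`, which permits differentiating it once more. -/
theorem E_eq {r : ℝ} (hr : r ∈ S.J) : S.E r = (N - 1) / N * (1 / S.f₁ r ^ 2) *
    (S.f₁ r ^ 2 / S.f₂ r ^ 2
      + (deriv (deriv S.f₂) r / S.f₂ r - deriv S.f₂ r ^ 2 / S.f₂ r ^ 2)
      - deriv S.f₁ r * deriv S.f₂ r / (S.f₁ r * S.f₂ r)
      + deriv S.b r / S.b r * (deriv S.f₁ r / S.f₁ r + deriv S.f₂ r / S.f₂ r)
      - deriv (deriv S.b) r / S.b r) := by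
  have h3 := f₁_ne_zero hr
  have h4 := f₂_ne_zero hr
  have hlog : (deriv fun s => Real.log (S.f₂ s)) =ᶠ[𝓝 r] fun s => deriv S.f₂ s / S.f₂ s := by
    filter_upwards [S.isOpen_J.mem_nhds hr] with s hs
    exact ((hasDerivAt_f₂ hs).log (f₂_ne_zero hs)).deriv
  have hprod := (((hasDerivAt_f₁ hr).fun_mul (hasDerivAt_f₂ hr)).log (mul_ne_zero h3 h4)).deriv
  rw [E, dim_sub_two, dim_sub_three, hlog.deriv_eq, (hasDerivAt_deriv_f₂_div_f₂ hr).deriv, hprod]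
  field_simp

/-! ### Tensors adapted to the frame of `u` and `N` -/

/-- The tensor `α u u + β (u N + N u) + γ N N + δ (h - N N)`. -/
def frameTensor (S : SphericalDW N) (x : Idx N → ℝ) (α β γ δ : ℝ) (i j : Idx N) : ℝ :=
  α * (S.u x i * S.u x j) + β * (S.u x i * S.radial x j + S.radial x i * S.u x j)
    + γ * (S.radial x i * S.radial x j) + δ * (S.h x i j - S.radial x i * S.radial x j)

theorem h_time_left (o : Unit) (j : Idx N) : S.h x (Sum.inl o) j = 0 := by
  rcases j with _ | _ | d
  · simp only [h, metric, u]
    ring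
  all_goals simp [h, metric, u]

theorem h_time_right (i : Idx N) (o : Unit) : S.h x i (Sum.inl o) = 0 := by
  rcases i with _ | _ | c
  · exact h_time_left _ _
  all_goals simp [h, metric, u]

theorem h_eq_metric (a b : Unit ⊕ Fin N) :
    S.h x (Sum.inr a) (Sum.inr b) = S.metric x (Sum.inr a) (Sum.inr b) := by
  simp [h, u]

theorem frameTensor_ang (α β γ δ : ℝ) (c d : Fin N) :
    S.frameTensor x α β γ δ (Sum.inr (Sum.inr c)) (Sum.inr (Sum.inr d)) =
      δ * (S.a (time x) ^ 2 * S.f₂ (rad x) ^ 2) * S.sphereMetric (ang x) c d := by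
  simp only [frameTensor, h_eq_metric, u, radial, metric]
  ring

theorem trace_frameTensor (hx : x ∈ S.domain) (α β γ δ : ℝ) :
    ∑ i, ∑ j, (S.metric x)⁻¹ i j * S.frameTensor x α β γ δ i j = -α + γ + N * δ := by
  have h1 := b_ne_zero hx.2.1
  have h2 := a_ne_zero hx.1
  have h3 := f₁_ne_zero hx.2.1
  have h4 := f₂_ne_zero hx.2.1
  rw [sum_inv_metric_mul hx (frameTensor_ang α β γ δ)]
  simp only [frameTensor, h_eq_metric, h_time_left, u, radial, metric]
  field_simp
  ring

section contractions

variable {T : (Idx N → ℝ) → Matrix (Idx N) (Idx N) ℝ} {α β γ δ : ℝ}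

theorem energyDensity_frameTensor (hx : x ∈ S.domain)
    (hT : ∀ i j, T x i j = S.frameTensor x α β γ δ i j) : S.energyDensity T x = α := by
  have h1 := b_ne_zero hx.2.1
  simp only [energyDensity, hT, raise_u hx, Fintype.sum_sum_type, Finset.univ_unique,
    Finset.sum_singleton, mul_zero, zero_mul, Finset.sum_const_zero, add_zero]
  simp only [frameTensor, h_time_left, u, radial]
  field_simp
  ring

theorem radialPressure_frameTensor (hx : x ∈ S.domain)
    (hT : ∀ i j, T x i j = S.frameTensor x α β γ δ i j) : S.radialPressure T x = γ := by
  have h2 := a_ne_zero hx.1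
  have h3 := f₁_ne_zero hx.2.1
  simp only [radialPressure, hT, raise_radial hx, Fintype.sum_sum_type, Finset.univ_unique,
    Finset.sum_singleton, mul_zero, zero_mul, Finset.sum_const_zero, add_zero, zero_add]
  simp only [frameTensor, h_eq_metric, u, radial, metric]
  field_simp
  ring

/-- `h^{ij}` differs from `g^{ij}` by `u^i u^j`, so the energy density cancels the `-α` of the full
trace. -/
theorem trace_hUp (hx : x ∈ S.domain) (hT : ∀ i j, T x i j = S.frameTensor x α β γ δ i j) :
    ∑ i, ∑ j, S.hUp x i j * T x i j = γ + N * δ := by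
  have he := energyDensity_frameTensor hx hT
  have htr := trace_frameTensor hx α β γ δ
  have : ∑ i, ∑ j, S.hUp x i j * T x i j =
      ∑ i, ∑ j, (S.metric x)⁻¹ i j * S.frameTensor x α β γ δ i j + S.energyDensity T x := by
    simp only [energyDensity, ← Finset.sum_add_distrib, hUp, ← hT]
    refine Finset.sum_congr rfl fun i _ => Finset.sum_congr rfl fun j _ => ?_
    ring
  rw [this, he, htr]
  ring

theorem pressure_frameTensor (hx : x ∈ S.domain)
    (hT : ∀ i j, T x i j = S.frameTensor x α β γ δ i j) :
    S.pressure T x = (γ + N * δ) / (N + 1) := by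
  rw [pressure, trace_hUp hx hT, dim_sub_one]

theorem tangentialPressure_frameTensor (hN : (N : ℝ) ≠ 0) (hx : x ∈ S.domain)
    (hT : ∀ i j, T x i j = S.frameTensor x α β γ δ i j) : S.tangentialPressure T x = δ := by
  have hr := radialPressure_frameTensor hx hT
  have : ∑ i, ∑ j, (S.hUp x i j - raise S.metric S.radial x i * raise S.metric S.radial x j)
      * T x i j = ∑ i, ∑ j, S.hUp x i j * T x i j - S.radialPressure T x := by
    simp only [radialPressure, ← Finset.sum_sub_distrib]
    refine Finset.sum_congr rfl fun i _ => Finset.sum_congr rfl fun j _ => ?_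
    ring
  rw [tangentialPressure, this, trace_hUp hx hT, hr, dim_sub_two]
  field_simp
  ring

theorem heatFlux_frameTensor (hx : x ∈ S.domain)
    (hT : ∀ i j, T x i j = S.frameTensor x α β γ δ i j) (j : Idx N) :
    S.heatFlux T x j = β * S.radial x j := by
  have h1 := b_ne_zero hx.2.1
  simp only [heatFlux, hT, hMix, raise_u hx, Fintype.sum_sum_type, Finset.univ_unique,
    Finset.sum_singleton, mul_zero, Finset.sum_const_zero, add_zero]
  rcases j with _ | _ | d <;>
    simp [frameTensor, h_time_right, u, radial, h1]
  field_simp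

end contractions

/-! ### Frame coefficients of the Ricci tensor -/

variable (S) in
/-- The `u u` component of the Ricci tensor. -/
def ricciUU (x : Idx N → ℝ) : ℝ := S.ricciTable x (Sum.inl ()) (Sum.inl ()) / S.b (rad x) ^ 2

variable (S) in
/-- The `N N` component of the Ricci tensor. -/
def ricciNN (x : Idx N → ℝ) : ℝ :=
  S.ricciTable x (Sum.inr (Sum.inl ())) (Sum.inr (Sum.inl ()))
    / (S.a (time x) ^ 2 * S.f₁ (rad x) ^ 2)

variable (S) in
/-- The tangential component of the Ricci tensor. -/
def ricciTan (x : Idx N → ℝ) : ℝ :=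
  let a := S.a (time x)
  let a' := deriv S.a (time x)
  let a'' := deriv (deriv S.a) (time x)
  let b := S.b (rad x)
  let b' := deriv S.b (rad x)
  let f₁ := S.f₁ (rad x)
  let f₁' := deriv S.f₁ (rad x)
  let f₂ := S.f₂ (rad x)
  let f₂' := deriv S.f₂ (rad x)
  let f₂'' := deriv (deriv S.f₂) (rad x)
  ((a * a'' + N * a' ^ 2) * f₂ ^ 2 / b ^ 2
    - f₂ * (f₂'' - f₁' * f₂' / f₁ + b' * f₂' / b) / f₁ ^ 2
    - (N - 1) * f₂' ^ 2 / f₁ ^ 2 + (N - 1)) / (a ^ 2 * f₂ ^ 2)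

theorem ricci_eq_frameTensor (hx : x ∈ S.domain) (i j : Idx N) :
    ricci S.metric x i j = S.frameTensor x (S.ricciUU x) (-(N * S.phi x * S.accelAmp x))
      (S.ricciNN x) (S.ricciTan x) i j := by
  have h1 := b_ne_zero hx.2.1
  have h2 := a_ne_zero hx.1
  have h3 := f₁_ne_zero hx.2.1
  have h4 := f₂_ne_zero hx.2.1
  rw [ricci_metric hx, phi_eq hx]
  rcases i with _ | _ | c <;> rcases j with _ | _ | d
  case inr.inr.inr.inr =>
    rw [frameTensor_ang]
    simp only [ricciTan, ricciTable]
    field_simp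
  all_goals
    simp only [frameTensor, h_time_left, h_time_right, h_eq_metric, u, radial, metric, ricciUU,
      ricciNN, accelAmp, ricciTable]
  all_goals try field_simp
  all_goals try ring

theorem scalarCurv_eq (hx : x ∈ S.domain) :
    scalarCurv S.metric x = -S.ricciUU x + S.ricciNN x + N * S.ricciTan x := by
  rw [← trace_frameTensor hx _ (-(N * S.phi x * S.accelAmp x)), scalarCurv]
  simp only [ricci_eq_frameTensor hx]

/-- This is the Raychaudhuri equation without shear and vorticity. -/
theorem ricciUU_eq (hx : x ∈ S.domain) : S.ricciUU x = -S.xi x + S.divAccel x := by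
  have h1 := b_ne_zero hx.2.1
  have h2 := a_ne_zero hx.1
  have h3 := f₁_ne_zero hx.2.1
  have h4 := f₂_ne_zero hx.2.1
  rw [xi_eq hx, divAccel_eq hx]
  simp only [ricciUU, ricciTable]
  field_simp
  ring

theorem deriv_b_ne_zero_of_accel_ne_zero (hx : x ∈ S.domain) (h : S.accel x ≠ 0) :
    deriv S.b (rad x) ≠ 0 := by
  intro h0
  apply h
  ext j
  simp [accel_eq hx, accelAmp, h0]

/-- The `a`-dependent terms involving `a'` and `a''` cancel in the difference. In `η + u̇^i ∇_i η /
(2η)` the squares of `b'` cancel too, leaving `(b''/b - b' f₁' / (b f₁)) / (a² f₁²)`; nonzero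
acceleration is needed only to divide by `η`. -/
theorem ricciNN_sub_ricciTan (hN : (N : ℝ) ≠ 0) (hx : x ∈ S.domain) (h : S.accel x ≠ 0) :
    S.ricciNN x - S.ricciTan x = S.accelAnisotropy x - N * (S.E (rad x) / S.a (time x) ^ 2) := by
  have h0 := deriv_b_ne_zero_of_accel_ne_zero hx h
  have h1 := b_ne_zero hx.2.1
  have h2 := a_ne_zero hx.1
  have h3 := f₁_ne_zero hx.2.1
  have h4 := f₂_ne_zero hx.2.1
  rw [accelAnisotropy, divAccel_eq hx, along_accel_eta hx, eta_eq hx, dim_sub_one, E_eq hx.2.1]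
  simp only [ricciNN, ricciTan, ricciTable, accelAmp]
  field_simp
  ring

theorem deriv_b_eq_zero (h : ∀ x ∈ S.domain, S.accel x = 0) (hx : x ∈ S.domain) :
    deriv S.b (rad x) = 0 := by
  have := accel_rad hx ()
  rw [h x hx] at this
  simpa [b_ne_zero hx.2.1] using this.symm

/-- Vanishing of the acceleration on the whole domain allows `u̇_r = b'/b = 0` to be differentiated;
vanishing at one point would not suffice. -/
theorem deriv_deriv_b_eq_zero (h : ∀ x ∈ S.domain, S.accel x = 0) (hx : x ∈ S.domain) :
    deriv (deriv S.b) (rad x) = 0 := by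
  have h1 := pd_accel hx (Sum.inr (Sum.inl ())) (Sum.inr (Sum.inl ()))
  rw [pd_congr_domain (g := fun _ => 0) hx fun y hy => by simp [h y hy], pd_const] at h1
  simpa [b_ne_zero hx.2.1, deriv_b_eq_zero h hx] using h1.symm

/-- Here `η = 0`, so the quotient formula is unavailable; instead every term with `b'` or `b''`
drops out, both from the Ricci coefficients and from `E`. -/
theorem ricciNN_sub_ricciTan_of_geodesic (hN : (N : ℝ) ≠ 0)
    (h : ∀ x ∈ S.domain, S.accel x = 0) (hx : x ∈ S.domain) :
    S.ricciNN x - S.ricciTan x = -(N * (S.E (rad x) / S.a (time x) ^ 2)) := by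
  have h1 := b_ne_zero hx.2.1
  have h2 := a_ne_zero hx.1
  have h3 := f₁_ne_zero hx.2.1
  have h4 := f₂_ne_zero hx.2.1
  rw [E_eq hx.2.1]
  simp only [ricciNN, ricciTan, ricciTable, deriv_b_eq_zero h hx, deriv_deriv_b_eq_zero h hx]
  field_simp
  ring

theorem divAccel_of_geodesic (h : ∀ x ∈ S.domain, S.accel x = 0) (hx : x ∈ S.domain) :
    S.divAccel x = 0 := by
  rw [divAccel_eq hx, deriv_b_eq_zero h hx, deriv_deriv_b_eq_zero h hx]
  simp

/-! ### The electric part of the Weyl tensor -/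

theorem riemannLow_time_time (x : Idx N → ℝ) (k l : Idx N) :
    riemannLow S.metric (Sum.inl ()) k l (Sum.inl ()) x =
      -(S.b (rad x) ^ 2) * riemann S.metric (Sum.inl ()) k l (Sum.inl ()) x := by
  simp [riemannLow, metric, Fintype.sum_sum_type]
  ring

theorem electric_eq (hN : (N : ℝ) ≠ 0) (hx : x ∈ S.domain) (k l : Idx N) :
    S.electric x k l = S.E (rad x) / S.a (time x) ^ 2 *
      (S.radial x k * S.radial x l - S.h x k l / (S.dim - 1)) := by
  have h1 := b_ne_zero hx.2.1
  have h2 := a_ne_zero hx.1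
  have h3 := f₁_ne_zero hx.2.1
  have h4 := f₂_ne_zero hx.2.1
  have h5 := natCast_add_one_ne_zero N
  -- `weyl` takes its dimension from the index type; this matches it with `N + 2`.
  have hcard : (Fintype.card (Idx N) : ℝ) = S.dim := by
    simp [Idx, dim]
    ring
  have hE : S.electric x k l =
      1 / S.b (rad x) ^ 2 * weyl S.metric (Sum.inl ()) k l (Sum.inl ()) x := by
    simp only [electric, raise_u hx, Fintype.sum_sum_type, Finset.univ_unique,
      Finset.sum_singleton, mul_zero, zero_mul, Finset.sum_const_zero, add_zero]
    rw [show (default : Unit) = () from rfl]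
    field_simp
  rw [hE, weyl]
  simp only [hcard, dim_sub_one, dim_sub_two, riemannLow_time_time x, riemann_time_time hx,
    scalarCurv_eq hx, ricci_metric hx, E_eq hx.2.1]
  rcases k with _ | _ | c <;> rcases l with _ | _ | d <;>
    simp only [h_time_left, h_time_right, h_eq_metric, radial, metric, ricciTable, ricciUU,
      ricciNN, ricciTan]
  all_goals field_simp
  all_goals try ring

end SphericalDW

end

/-! ### Assembly of the theorem -/

theorem mainTheorem4 (N : ℕ) (hN : 1 ≤ N) (S : SphericalDW N) :
    -- the electric tensor, which identifies `E(r)`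
    (∀ x ∈ S.domain, ∀ j k : Idx N,
      S.electric x j k =
        S.E (SphericalDW.rad x) / S.a (SphericalDW.time x) ^ 2 *
          (S.radial x j * S.radial x k - S.h x j k / (S.dim - 1))) ∧
    -- the Ricci tensor where the acceleration does not vanish
    (∀ x ∈ S.domain, S.accel x ≠ 0 → ∀ j k : Idx N,
      S.radial x j * S.radial x k = S.accel x j * S.accel x k / S.eta x ∧
      ChartGeometry.ricci S.metric x j k =
        S.u x j * S.u x k * (-S.xi x + S.divAccel x)
        + S.h x j k / (S.dim - 1) *
            (ChartGeometry.scalarCurv S.metric x - S.xi x + S.divAccel x)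
        - (S.dim - 2) * S.phi x * (S.u x j * S.accel x k + S.accel x j * S.u x k)
        + (S.accel x j * S.accel x k / S.eta x - S.h x j k / (S.dim - 1)) *
            (S.accelAnisotropy x
              - (S.dim - 2) * (S.E (SphericalDW.rad x) / S.a (SphericalDW.time x) ^ 2))) ∧
    -- the Ricci tensor if the acceleration is identically zero
    ((∀ x ∈ S.domain, S.accel x = 0) → ∀ x ∈ S.domain, ∀ j k : Idx N,
      ChartGeometry.ricci S.metric x j k =
        -S.xi x * (S.u x j * S.u x k)
        + (ChartGeometry.scalarCurv S.metric x - S.xi x) / (S.dim - 1) * S.h x j k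
        - (S.dim - 2) * (S.radial x j * S.radial x k - S.h x j k / (S.dim - 1)) *
            (S.E (SphericalDW.rad x) / S.a (SphericalDW.time x) ^ 2)) ∧
    -- the energy-momentum tensor determined by the Einstein equations
    (∀ T : (Idx N → ℝ) → Matrix (Idx N) (Idx N) ℝ,
      ChartGeometry.EinsteinEq S.metric T S.domain →
      (∀ x ∈ S.domain,
        (∀ i j : Idx N,
          T x i j =
            S.energyDensity T x * (S.u x i * S.u x j)
            + S.pressure T x * S.h x i j
            + (S.u x i * S.heatFlux T x j + S.u x j * S.heatFlux T x i)
            + (S.radial x i * S.radial x j - S.h x i j / (S.dim - 1)) *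
                (S.radialPressure T x - S.tangentialPressure T x)) ∧
        S.pressure T x =
          1 / (S.dim - 1) * S.radialPressure T x
          + (S.dim - 2) / (S.dim - 1) * S.tangentialPressure T x ∧
        S.energyDensity T x =
          -S.xi x + S.divAccel x + (1 / 2) * ChartGeometry.scalarCurv S.metric x ∧
        (S.dim - 1) * S.pressure T x =
          -S.xi x + S.divAccel x
          - (1 / 2) * (S.dim - 3) * ChartGeometry.scalarCurv S.metric x ∧
        (∀ j : Idx N, S.heatFlux T x j = -(S.dim - 2) * S.phi x * S.accel x j)) ∧
      (∀ x ∈ S.domain, S.accel x ≠ 0 →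
        S.radialPressure T x - S.tangentialPressure T x =
          S.accelAnisotropy x
          - (S.dim - 2) * (S.E (SphericalDW.rad x) / S.a (SphericalDW.time x) ^ 2)) ∧
      ((∀ x ∈ S.domain, S.accel x = 0) → ∀ x ∈ S.domain,
        S.radialPressure T x - S.tangentialPressure T x =
          -(S.dim - 2) * (S.E (SphericalDW.rad x) / S.a (SphericalDW.time x) ^ 2))) := by
  have hN0 : (N : ℝ) ≠ 0 := by exact_mod_cast (by omega : N ≠ 0)
  have hN1 := SphericalDW.natCast_add_one_ne_zero N
  refine ⟨fun x hx j k => SphericalDW.electric_eq hN0 hx j k, fun x hx hacc j k => ?_,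
    fun hgeo x hx j k => ?_, fun T hT => ?_⟩
  -- With `u̇ = A N` and `η = A²`, a nonzero `A` can be cancelled from `u̇ u̇ / η`.
  · have hAmp : S.accelAmp x ≠ 0 := fun h0 =>
      hacc (by ext j; rw [SphericalDW.accel_eq hx, h0, zero_mul]; rfl)
    have hNN : S.radial x j * S.radial x k = S.accel x j * S.accel x k / S.eta x := by
      rw [SphericalDW.accel_eq hx, SphericalDW.accel_eq hx, SphericalDW.eta_eq hx]
      field_simp
    refine ⟨hNN, ?_⟩
    rw [← hNN, SphericalDW.dim_sub_one, SphericalDW.dim_sub_two,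
      ← SphericalDW.ricciNN_sub_ricciTan hN0 hx hacc, SphericalDW.scalarCurv_eq hx,
      SphericalDW.ricci_eq_frameTensor hx, SphericalDW.ricciUU_eq hx, SphericalDW.accel_eq hx,
      SphericalDW.accel_eq hx, SphericalDW.frameTensor]
    field_simp
    ring
  · have hUU := SphericalDW.ricciUU_eq hx
    rw [SphericalDW.divAccel_of_geodesic hgeo hx, add_zero] at hUU
    have hA : S.accelAmp x = 0 := by
      simp [SphericalDW.accelAmp, SphericalDW.deriv_b_eq_zero hgeo hx]
    have hd := SphericalDW.ricciNN_sub_ricciTan_of_geodesic hN0 hgeo hx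
    rw [SphericalDW.dim_sub_one, SphericalDW.dim_sub_two, SphericalDW.scalarCurv_eq hx,
      SphericalDW.ricci_eq_frameTensor hx, hUU, hA, SphericalDW.frameTensor]
    have hd' : S.ricciNN x = S.ricciTan x -
      N * (S.E (SphericalDW.rad x) / S.a (SphericalDW.time x) ^ 2) := by linarith
    rw [hd']
    field_simp
    ring
  -- The metric is the frame tensor with coefficients `-1, 0, 1, 1`, so `-R g / 2` only shifts the
  -- diagonal coefficients.
  · have hTf : ∀ x ∈ S.domain, ∀ i j, T x i j = S.frameTensor x
        (S.ricciUU x + 1 / 2 * ChartGeometry.scalarCurv S.metric x)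
        (-(N * S.phi x * S.accelAmp x))
        (S.ricciNN x - 1 / 2 * ChartGeometry.scalarCurv S.metric x)
        (S.ricciTan x - 1 / 2 * ChartGeometry.scalarCurv S.metric x) i j := by
      intro x hx i j
      rw [← hT x hx, SphericalDW.ricci_eq_frameTensor hx, SphericalDW.frameTensor,
        SphericalDW.frameTensor, SphericalDW.h]
      ring
    have hr := fun x hx => SphericalDW.radialPressure_frameTensor hx (hTf x hx)
    have ht := fun x hx => SphericalDW.tangentialPressure_frameTensor hN0 hx (hTf x hx)
    refine ⟨fun x hx => ?_, fun x hx hacc => ?_, fun hgeo x hx => ?_⟩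
    · have hμ := SphericalDW.energyDensity_frameTensor hx (hTf x hx)
      have hP := SphericalDW.pressure_frameTensor hx (hTf x hx)
      have hq := SphericalDW.heatFlux_frameTensor hx (hTf x hx)
      refine ⟨fun i j => ?_, ?_, ?_, ?_, fun j => ?_⟩
      · rw [hμ, hP, hq, hq, hr x hx, ht x hx, SphericalDW.dim_sub_one, hTf x hx,
          SphericalDW.frameTensor]
        field_simp
        ring
      · rw [hP, hr x hx, ht x hx, SphericalDW.dim_sub_one, SphericalDW.dim_sub_two]
        field_simp
      · rw [hμ, SphericalDW.ricciUU_eq hx]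
      · rw [hP, ← SphericalDW.ricciUU_eq hx, SphericalDW.scalarCurv_eq hx,
          SphericalDW.dim_sub_one, SphericalDW.dim_sub_three]
        field_simp
        ring
      · rw [hq, SphericalDW.accel_eq hx, SphericalDW.dim, SphericalDW.phi]
        ring
    -- Both pressures carry the same shift `-R/2`, so their difference is that of the Ricci
    -- coefficients.
    · rw [hr x hx, ht x hx, sub_sub_sub_cancel_right, SphericalDW.dim_sub_two]
      exact SphericalDW.ricciNN_sub_ricciTan hN0 hx hacc
    · rw [hr x hx, ht x hx, sub_sub_sub_cancel_right, SphericalDW.dim_sub_two, neg_mul]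
      exact SphericalDW.ricciNN_sub_ricciTan_of_geodesic hN0 hgeo hx
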